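/- Consider the fading AWGN channel $Y = HX + Z$ with $Z \sim \mathcal{CN}(0,1)$ independent of the state, where the fading coefficient $H \in \mathbb{C}$ has $\mathrm{E}[|H|^2] = 1$, and where the channel state information at the transmitter (CSIT) is a random variable $S_T$, with values in a standard Borel space $\mathcal{S}_T$ and arbitrarily jointly distributed with $H$. Over $n$ channel uses the pairs $(H_i, S_{T,i})$ are i.i.d., the noise is i.i.d. and independent of them, the transmitter knows $S_T$ causally (the input $X_i$ is a function of the message and of $S_{T,1},\dots,S_{T,i}$), and the receiver sees $(Y_i, H_i)$, $i=1,\dots,n$, i.e., $S_R = H$. Let $P(\cdot) : \mathcal{S}_T \to [0,\infty)$ be a measurable power control policy with $\mathrm{E}[P(S_T)] \le P$. Define $$\mathrm{SNR}(h) = \frac{|h|^2 \left(\mathrm{E}\big[\sqrt{P(S_T)} \,\big|\, H=h\big]\right)^2}{1 + |h|^2\, \mathrm{Var}\big[\sqrt{P(S_T)} \,\big|\, H=h\big]} ,$$ where the variance is that of the conditional law of $\sqrt{P(S_T)}$ given $H=h$, and let $\log$ be the natural logarithm. Then $\mathrm{E}[\log(1+\mathrm{SNR}(H))]$ is finite and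 the following hold. 1. (Forward model GMI.) Consider adaptive symbols $A = [X(s_T) : s_T \in \mathcal{S}_T]$, independent of $(H,S_T,Z)$, with jointly circularly-symmetric complex Gaussian entries of variances $\mathrm{E}[|X(s_T)|^2] = P(s_T)$, where $X(S_T)$ is transmitted (and $X(\cdot)$ is jointly measurable), and auxiliary densities $$q(y|a,h) = \frac{1}{\pi \sigma^2(h)} \exp\left(-\frac{|y - g(h)\, \bar x(h)|^2}{\sigma^2(h)}\right), \qquad g(h) \in \mathbb{C},\ \sigma^2(h) > 0,$$ where for each $h$ the variable $\bar X(h)$ is a linear function $\sum_{s_T} w(s_T,h) X(s_T)$ of the entries of $A$, or a mean-square limit of finite sums of this form. For $s\ge 0$ let $$I_s(A;Y|H) = \int p(h)\, \mathrm{E}\left[\left.\log \frac{q(Y|A,h)^s}{\int p(a)\, q(Y|a,h)^s\, da} \,\right|\, H=h\right] dh .$$ Then the maximum of $I_s(A;Y|H)$ over all such $A$, $\bar X(\cdot)$, $g(\cdot)$, $\sigma^2(\cdot)$ and $s \ge 0$ for which the outer integral is well defined and finite exists and equals $\mathrm{E}[\log(1+\mathrm{SNR}(H))]$. 2. (Achievability.)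 The rate $R = \mathrm{E}[\log(1+\mathrm{SNR}(H))]$ (in nats per channel use) is achievable under the average power constraint $P$: for every $\varepsilon>0$ and all sufficiently large $n$ there is a length-$n$ code with causal CSIT and receiver side information $H^n$ that has at least $e^{n(R-\varepsilon)}$ messages, error probability at most $\varepsilon$ for uniformly distributed messages, and $\frac1n \sum_{i=1}^n \mathrm{E}[|X_i|^2] \le P$. -/

import Mathlib

open MeasureTheory ProbabilityTheory
open scoped NNReal ENNReal

noncomputable section

namespace FadingCSIT

/-! ### Circularly-symmetric complex Gaussian (CSCG) variables -/

/-- The law `𝒞𝒩(0, v)`: independent real and imaginary parts, each `𝒩(0, v / 2)`.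
For `v = 0` it is the unit mass at `0`. -/
def cscg (v : ℝ≥0) : Measure ℂ :=
  ((gaussianReal 0 (v / 2)).prod (gaussianReal 0 (v / 2))).map fun p => (⟨p.1, p.2⟩ : ℂ)

/-- A family of complex random variables is jointly CSCG if every finite complex linear
combination of its members is CSCG. -/
def IsJointlyCSCG {ι A : Type*} [MeasurableSpace A] (P : Measure A) (X : ι → A → ℂ) : Prop :=
  ∀ w : ι →₀ ℂ, ∃ v : ℝ≥0, P.map (fun a => w.sum fun i c => c * X i a) = cscg v

/-! ### Forward auxiliary models and their generalized mutual information -/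

/-- An adaptive symbol `A = [X(s) : s ∈ 𝒮]` with jointly CSCG entries of powers `E|X(s)|² = Pol s`,
together with a forward auxiliary model for a receiver that knows the fading coefficient `h`:
`Y = gain h * Xbar h + noise`, with noise `𝒞𝒩(0, noiseVar h)`, where `Xbar h` is a
linear function of the entries of `A`. -/
structure ForwardModel {𝒮 : Type*} [MeasurableSpace 𝒮] (Pol : 𝒮 → ℝ≥0) where
  /-- the alphabet of the adaptive symbol -/
  A : Type
  [measurableSpace : MeasurableSpace A]
  /-- the law of the adaptive symbol -/
  P : Measure A
  [isProbabilityMeasure : IsProbabilityMeasure P]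
  /-- `X s` is the channel input that is sent when the CSIT is `s` -/
  X : 𝒮 → A → ℂ
  measurable_X : Measurable (Function.uncurry X)
  jointlyCSCG : IsJointlyCSCG P X
  law_X : ∀ s, P.map (X s) = cscg (Pol s)
  /-- the auxiliary input -/
  Xbar : ℂ → A → ℂ
  measurable_Xbar : ∀ h, Measurable (Xbar h)
  /-- `Xbar h` is a weighted sum `∑ s, w s * X s`, or a mean-square limit of such sums when the
  CSIT alphabet is infinite. -/
  linear_Xbar : ∀ h : ℂ, ∀ ε : ℝ≥0∞, 0 < ε → ∃ w : 𝒮 →₀ ℂ,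
    eLpNorm (fun a => Xbar h a - w.sum fun s c => c * X s a) 2 P ≤ ε
  /-- the channel gain of the auxiliary model -/
  gain : ℂ → ℂ
  /-- the noise variance of the auxiliary model -/
  noiseVar : ℂ → ℝ
  noiseVar_pos : ∀ h, 0 < noiseVar h

attribute [instance] ForwardModel.measurableSpace ForwardModel.isProbabilityMeasure

namespace ForwardModel

variable {𝒮 : Type*} [MeasurableSpace 𝒮] {Pol : 𝒮 → ℝ≥0}

/-- The auxiliary channel density `q(y | a, h)`. -/
def q (F : ForwardModel Pol) (h y : ℂ) (a : F.A) : ℝ :=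
  1 / (Real.pi * F.noiseVar h) * Real.exp (-(‖y - F.gain h * F.Xbar h a‖ ^ 2 / F.noiseVar h))

/-- `q(y | h) = ∫ p(a) q(y | a, h) ^ t da`. -/
def qOut (F : ForwardModel Pol) (t : ℝ) (h y : ℂ) : ℝ :=
  ∫ a, F.q h y a ^ t ∂F.P

/-- `I_t(A; Y | H = h) = E[log (q(Y | A, h) ^ t / q(Y | h)) | H = h]`. Under the true law given
`H = h`, the variables `A`, `S_T ∼ κ h`, `Z ∼ 𝒞𝒩(0, 1)` are independent, and
`Y = h * X(S_T) + Z`. -/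
def gmiAt (F : ForwardModel Pol) (κ : Kernel ℂ 𝒮) (t : ℝ) (h : ℂ) : ℝ :=
  ∫ p : F.A × 𝒮 × ℂ,
    Real.log (F.q h (h * F.X p.2.1 p.1 + p.2.2) p.1 ^ t /
      F.qOut t h (h * F.X p.2.1 p.1 + p.2.2))
    ∂(F.P.prod ((κ h).prod (cscg 1)))

end ForwardModel

/-- The values `I_t(A; Y | H) = ∫ p(h) I_t(A; Y | H = h) dh`, `t ≥ 0`, for all forward models
with power policy `Pol`; `PH` is the law of `H` and `κ h` the law of `S_T` given `H = h`. -/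
def forwardGMIs {𝒮 : Type*} [MeasurableSpace 𝒮] (PH : Measure ℂ) (κ : Kernel ℂ 𝒮)
    (Pol : 𝒮 → ℝ≥0) : Set ℝ :=
  {r | ∃ (F : ForwardModel Pol) (t : ℝ), 0 ≤ t ∧
    Integrable (F.gmiAt κ t) PH ∧ r = ∫ h, F.gmiAt κ t h ∂PH}

/-- `SNR(h) = |h|² (E[√P(S_T) | H = h])² / (1 + |h|² Var[√P(S_T) | H = h])`. -/
def snr {𝒮 : Type*} [MeasurableSpace 𝒮] (κ : Kernel ℂ 𝒮) (Pol : 𝒮 → ℝ≥0) (h : ℂ) : ℝ :=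
  ‖h‖ ^ 2 * (∫ s, √(Pol s : ℝ) ∂κ h) ^ 2 /
    (1 + ‖h‖ ^ 2 * variance (fun s => √(Pol s : ℝ)) (κ h))

/-! ### Codes with causal CSIT and full CSIR -/

/-- A block code of length `n` with `M` messages. The input at time `i` is a function of the
message and of the CSIT up to time `i`; the receiver observes the pairs `(Y_i, H_i)`. -/
structure Code (𝒮 : Type*) [MeasurableSpace 𝒮] (n M : ℕ) where
  enc : (i : Fin n) → Fin M → ({j : Fin n // j ≤ i} → 𝒮) → ℂ
  measurable_enc : ∀ i m, Measurable (enc i m)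
  dec : (Fin n → ℂ × ℂ) → Fin M
  measurable_dec : Measurable dec

namespace Code

variable {𝒮 : Type*} [MeasurableSpace 𝒮] {n M : ℕ}

/-- The input `X_i` for message `m` when the states are `σ_j = (H_j, S_{T,j})`. -/
def input (C : Code 𝒮 n M) (m : Fin M) (σ : Fin n → ℂ × 𝒮) (i : Fin n) : ℂ :=
  C.enc i m fun j => (σ j).2

/-- What the receiver observes: `(Y_i, H_i)` with `Y_i = H_i X_i + Z_i`. -/
def received (C : Code 𝒮 n M) (m : Fin M) (σ : Fin n → ℂ × 𝒮) (z : Fin n → ℂ) :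
    Fin n → ℂ × ℂ :=
  fun i => ((σ i).1 * C.input m σ i + z i, (σ i).1)

/-- The probability that a uniformly distributed message is decoded incorrectly, for i.i.d. states
`(H_i, S_{T,i})` of law `ν` and independent i.i.d. noise `Z_i ∼ 𝒞𝒩(0, 1)`. -/
def errorProb (C : Code 𝒮 n M) (ν : Measure (ℂ × 𝒮)) : ℝ :=
  (∑ m : Fin M, ((Measure.pi fun _ : Fin n => ν).prod (Measure.pi fun _ : Fin n => cscg 1)).real
    {p | C.dec (C.received m p.1 p.2) ≠ m}) / M

/-- The average power `(1 / n) ∑ i, E|X_i|²` for a uniformly distributed message. -/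
def avgPower (C : Code 𝒮 n M) (ν : Measure (ℂ × 𝒮)) : ℝ≥0∞ :=
  (∑ m : Fin M, ∑ i : Fin n,
    ∫⁻ σ, ‖C.input m σ i‖ₑ ^ 2 ∂(Measure.pi fun _ : Fin n => ν)) / (M * n)

end Code

/-- `R` (in nats per channel use) is achievable under the average power constraint `Pmax` on the
fading channel whose states `(H, S_T)` have joint law `ν`. -/
def IsAchievableRate {𝒮 : Type*} [MeasurableSpace 𝒮] (ν : Measure (ℂ × 𝒮)) (Pmax : ℝ≥0)
    (R : ℝ) : Prop :=
  ∀ ε : ℝ, 0 < ε → ∃ N : ℕ, ∀ n : ℕ, N ≤ n → ∃ (M : ℕ) (C : Code 𝒮 n M),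
    Real.exp (n * (R - ε)) ≤ M ∧ C.errorProb ν ≤ ε ∧ C.avgPower ν ≤ Pmax

end FadingCSIT

end

noncomputable section

namespace FadingCSIT

/-! ### Facts about CSCG variables -/

/-! Converse. Fix `h` and let `U` be the auxiliary signal (gain times auxiliary input), with power
`V`. As a mean-square limit of CSCG variables, `U` has a Gaussian transform, so the output density
is Gaussian up to a constant. An exponent `t > 0` merely turns the noise variance into `a = σ² / t`.
The log-ratio is then quadratic in `(Y, U)`, and its mean `log (1 + V/a) + E|Y|²/(a + V) - E|Y -
U|²/a` depends only on second moments (`gmiAt_eq`). The correlation is at most `c √V` with `c = |h|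
E[√P | h]`, by Cauchy–Schwarz for each CSIT value (`correlation_le`). The tangent inequality for the
logarithm and a completed square then bound the mean by `log (1 + c² / (E|Y|² - c²))`, which is `log
(1 + SNR(h))` (`log_add_sub_le`). Equality holds when all entries are scalings `√P(s) W` of a single
Gaussian and the model is the linear MMSE one (`gmiAt_optimalModel`). Integrating over `h` gives the
maximum.

Achievability. Draw codewords i.i.d. from the law of `W` and decode with a threshold on the sum of
information densities of the optimal model. Under the true law the density has mean `R` and is
integrable (`integrable_infoDensity`), so a law of large numbers makes the sent codeword pass. For
every fixed observation the exponential of the density averages to one over an independent symbol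
(`integral_exp_infoDensity`), so Markov's inequality makes each competitor pass with probability at
most `exp (-θ)`. The true channel need not be Gaussian for this.

A single codebook must have both small error and exact power. Shrinking the policy by `1 - δ` leaves
slack: a weighted sum of the two figures of merit has mean at most one, so some codebook satisfies
both constraints. The shrinking costs at most `δ R` in rate, by concavity of the logarithm
(`mul_integral_log_le`). -/

instance isProbabilityMeasure_cscg (v : ℝ≥0) : IsProbabilityMeasure (cscg v) :=
  Measure.isProbabilityMeasure_map Complex.measurableEquivRealProd.symm.measurable.aemeasurable

lemma integrable_sq_gaussianReal (m : ℝ) (v : ℝ≥0) :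
    Integrable (fun x : ℝ => x ^ 2) (gaussianReal m v) :=
  (memLp_id_gaussianReal' (μ := m) (v := v) 2 (by simp)).integrable_sq

lemma integral_sq_gaussianReal (v : ℝ≥0) : ∫ x, x ^ 2 ∂gaussianReal 0 v = v := by
  have h := variance_fun_id_gaussianReal (μ := 0) (v := v)
  rw [variance_eq_integral (by fun_prop), integral_id_gaussianReal] at h
  simpa using h

lemma measurableEmbedding_complex_mk : MeasurableEmbedding fun p : ℝ × ℝ => (⟨p.1, p.2⟩ : ℂ) :=
  Complex.measurableEquivRealProd.symm.measurableEmbedding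

lemma integral_cscg {E : Type*} [NormedAddCommGroup E] [NormedSpace ℝ E] (v : ℝ≥0) (f : ℂ → E) :
    ∫ z, f z ∂cscg v = ∫ p : ℝ × ℝ, f ⟨p.1, p.2⟩
      ∂((gaussianReal 0 (v / 2)).prod (gaussianReal 0 (v / 2))) :=
  measurableEmbedding_complex_mk.integral_map f

lemma integrable_cscg {E : Type*} [NormedAddCommGroup E] (v : ℝ≥0) (f : ℂ → E) :
    Integrable f (cscg v) ↔ Integrable (fun p : ℝ × ℝ => f ⟨p.1, p.2⟩)
      ((gaussianReal 0 (v / 2)).prod (gaussianReal 0 (v / 2))) :=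
  measurableEmbedding_complex_mk.integrable_map_iff

lemma norm_complex_mk_sq (x y : ℝ) : ‖(⟨x, y⟩ : ℂ)‖ ^ 2 = x ^ 2 + y ^ 2 := by
  rw [Complex.sq_norm, Complex.normSq_mk]; ring

lemma integrable_norm_sq_cscg (v : ℝ≥0) : Integrable (fun z => ‖z‖ ^ 2) (cscg v) := by
  rw [integrable_cscg]
  simp only [norm_complex_mk_sq]
  exact ((integrable_sq_gaussianReal 0 _).comp_fst _).add
    ((integrable_sq_gaussianReal 0 _).comp_snd _)

lemma integral_norm_sq_cscg (v : ℝ≥0) : ∫ z, ‖z‖ ^ 2 ∂cscg v = v := by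
  rw [integral_cscg]
  simp only [norm_complex_mk_sq]
  rw [integral_add ((integrable_sq_gaussianReal 0 _).comp_fst _)
    ((integrable_sq_gaussianReal 0 _).comp_snd _), integral_fun_fst (f := fun x : ℝ => x ^ 2),
    integral_fun_snd (f := fun x : ℝ => x ^ 2), integral_sq_gaussianReal]
  simp

lemma lintegral_enorm_sq_cscg (v : ℝ≥0) : ∫⁻ z, ‖z‖ₑ ^ 2 ∂cscg v = v := by
  have h := ofReal_integral_eq_lintegral_ofReal (integrable_norm_sq_cscg v)
    (Filter.Eventually.of_forall fun z => by positivity)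
  rw [integral_norm_sq_cscg, ENNReal.ofReal_coe_nnreal] at h
  rw [h]
  refine lintegral_congr fun z => ?_
  rw [ENNReal.ofReal_pow (norm_nonneg _), ofReal_norm]

lemma memLp_two_id_cscg (v : ℝ≥0) : MemLp (fun z : ℂ => z) 2 (cscg v) := by
  rw [memLp_two_iff_integrable_sq_norm (by fun_prop)]
  exact integrable_norm_sq_cscg v

lemma integrable_id_cscg (v : ℝ≥0) : Integrable (fun z : ℂ => z) (cscg v) :=
  (memLp_two_id_cscg v).integrable one_le_two

lemma integral_id_cscg (v : ℝ≥0) : ∫ z, z ∂cscg v = 0 := by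
  have hi := (integrable_cscg v fun z => z).1 (integrable_id_cscg v)
  rw [integral_cscg]
  apply Complex.ext
  · rw [← RCLike.re_eq_complex_re, ← integral_re hi]
    simp only [RCLike.re_eq_complex_re]
    rw [integral_fun_fst (f := fun x : ℝ => x), integral_id_gaussianReal]
    simp
  · rw [← RCLike.im_eq_complex_im, ← integral_im hi]
    simp only [RCLike.im_eq_complex_im]
    rw [integral_fun_snd (f := fun x : ℝ => x), integral_id_gaussianReal]
    simp

/-- Completing the square: the integrand times the density is a constant multiple of the Gaussian
density with mean `y v / (a + v)` and variance `w`. The case `v = 0` is a point mass without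
density. -/
lemma integral_exp_neg_sq_gaussianReal (v : ℝ≥0) {a : ℝ} (ha : 0 < a) (y : ℝ) :
    ∫ x, Real.exp (-((y - x) ^ 2 / a)) ∂gaussianReal 0 (v / 2) =
      √(a / (a + v)) * Real.exp (-(y ^ 2 / (a + v))) := by
  rcases eq_or_ne v 0 with rfl | hv
  · simp [ha.ne']
  have hv0 : (0 : ℝ) < v := by positivity
  rw [integral_gaussianReal_eq_integral_smul (by simpa using hv)]
  let w : ℝ≥0 := ⟨v * a / (2 * (a + v)), by positivity⟩
  have hw : w ≠ 0 := by
    rw [← NNReal.coe_ne_zero]; change v * a / (2 * (a + v)) ≠ 0; positivity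
  have key : ∀ x : ℝ, gaussianPDFReal 0 (v / 2) x • Real.exp (-((y - x) ^ 2 / a)) =
      (√(a / (a + v)) * Real.exp (-(y ^ 2 / (a + v)))) *
        gaussianPDFReal (y * v / (a + v)) w x := by
    intro x
    simp only [gaussianPDFReal, smul_eq_mul]
    have h1 : (√(2 * Real.pi * ((v / 2 : ℝ≥0) : ℝ)))⁻¹ =
        √(a / (a + v)) * (√(2 * Real.pi * (w : ℝ)))⁻¹ := by
      rw [← Real.sqrt_inv, ← Real.sqrt_inv, ← Real.sqrt_mul (by positivity)]
      congr 1
      change (2 * Real.pi * ((v : ℝ) / 2))⁻¹ =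
        a / (a + v) * (2 * Real.pi * (v * a / (2 * (a + v))))⁻¹
      field_simp
    rw [h1]
    have h2 : Real.exp (-(x - 0) ^ 2 / (2 * ((v / 2 : ℝ≥0) : ℝ))) *
          Real.exp (-((y - x) ^ 2 / a)) =
        Real.exp (-(y ^ 2 / (a + v))) * Real.exp (-(x - y * v / (a + v)) ^ 2 / (2 * (w : ℝ))) := by
      rw [← Real.exp_add, ← Real.exp_add]
      congr 1
      change -(x - 0) ^ 2 / (2 * ((v : ℝ) / 2)) + -((y - x) ^ 2 / a) =
        -(y ^ 2 / (a + v)) + -(x - y * v / (a + v)) ^ 2 / (2 * (v * a / (2 * (a + v))))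
      field_simp
      ring
    linear_combination (√(a / (a + v)) * (√(2 * Real.pi * (w : ℝ)))⁻¹) * h2
  simp_rw [key]
  rw [integral_const_mul, integral_gaussianPDFReal_eq_one _ hw, mul_one]

lemma integral_exp_neg_norm_sub_sq_cscg (v : ℝ≥0) {a : ℝ} (ha : 0 < a) (y : ℂ) :
    ∫ u, Real.exp (-(‖y - u‖ ^ 2 / a)) ∂cscg v =
      a / (a + v) * Real.exp (-(‖y‖ ^ 2 / (a + v))) := by
  rw [integral_cscg]
  have h : ∀ p : ℝ × ℝ, Real.exp (-(‖y - ⟨p.1, p.2⟩‖ ^ 2 / a)) =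
      Real.exp (-((y.re - p.1) ^ 2 / a)) * Real.exp (-((y.im - p.2) ^ 2 / a)) := by
    intro p
    have : y - ⟨p.1, p.2⟩ = ⟨y.re - p.1, y.im - p.2⟩ := by apply Complex.ext <;> simp
    rw [this, norm_complex_mk_sq, ← Real.exp_add]
    congr 1; ring
  simp_rw [h]
  rw [integral_prod_mul (fun x : ℝ => Real.exp (-((y.re - x) ^ 2 / a)))
    (fun x : ℝ => Real.exp (-((y.im - x) ^ 2 / a))), integral_exp_neg_sq_gaussianReal v ha,
    integral_exp_neg_sq_gaussianReal v ha]
  have h1 : √(a / (a + v)) * √(a / (a + v)) = a / (a + v) := Real.mul_self_sqrt (by positivity)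
  have h2 : Real.exp (-(‖y‖ ^ 2 / (a + v))) =
      Real.exp (-(y.re ^ 2 / (a + v))) * Real.exp (-(y.im ^ 2 / (a + v))) := by
    rw [← Real.exp_add, Complex.sq_norm, Complex.normSq_apply]
    congr 1; ring
  rw [h2]
  linear_combination (Real.exp (-(y.re ^ 2 / (a + v))) * Real.exp (-(y.im ^ 2 / (a + v)))) * h1

lemma charFun_cscg (v : ℝ≥0) (t : ℂ) :
    charFun (cscg v) t = Complex.exp (-(v * ‖t‖ ^ 2 / 4)) := by
  rw [charFun_apply, integral_cscg]
  have h : ∀ p : ℝ × ℝ, Complex.exp (inner ℝ (⟨p.1, p.2⟩ : ℂ) t * Complex.I) =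
      Complex.exp (t.re * p.1 * Complex.I) * Complex.exp (t.im * p.2 * Complex.I) := by
    intro p
    rw [← Complex.exp_add]
    congr 1
    simp [Complex.inner]
    ring
  simp_rw [h]
  rw [integral_prod_mul (fun x : ℝ => Complex.exp (t.re * x * Complex.I))
    (fun x : ℝ => Complex.exp (t.im * x * Complex.I))]
  have h' : ∀ s : ℝ, ∫ x : ℝ, Complex.exp (s * x * Complex.I) ∂gaussianReal 0 (v / 2) =
      Complex.exp (-(v * s ^ 2 / 4)) := by
    intro s
    rw [← charFun_apply_real, charFun_gaussianReal]
    congr 1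
    simp; ring
  rw [h', h', ← Complex.exp_add]
  congr 1
  have : ((‖t‖ : ℂ)) ^ 2 = t.re ^ 2 + t.im ^ 2 := by
    rw [← Complex.ofReal_pow, Complex.sq_norm, Complex.normSq_apply]; push_cast; ring
  rw [this]; ring

/-- The adjoint of multiplication by `c` is multiplication by its conjugate, and the characteristic
function sees only the norm of its argument. -/
lemma map_const_mul_cscg (v : ℝ≥0) (c : ℂ) :
    (cscg v).map (fun z => c * z) = cscg (‖c‖₊ ^ 2 * v) := by
  have : IsProbabilityMeasure ((cscg v).map (fun z => c * z)) :=
    Measure.isProbabilityMeasure_map (by fun_prop)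
  apply Measure.ext_of_charFun
  ext t
  rw [charFun_cscg, charFun_apply, integral_map (by fun_prop) (by fun_prop)]
  have h : ∀ z : ℂ, inner ℝ (c * z) t = inner ℝ z (starRingEnd ℂ c * t) := by
    intro z; simp [Complex.inner]; ring
  simp_rw [h]
  rw [← charFun_apply, charFun_cscg]
  congr 1
  simp; ring

/-! ### Square-integrable functions -/

lemma memLp_two_of_map_eq_cscg {A : Type*} [MeasurableSpace A] {P : Measure A} {S : A → ℂ}
    (hS : Measurable S) {v : ℝ≥0} (h : P.map S = cscg v) : MemLp S 2 P := by
  have := memLp_two_id_cscg v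
  rw [← h] at this
  exact (memLp_map_measure_iff (by fun_prop) hS.aemeasurable).1 this

lemma integral_comp_of_map_eq_cscg {A : Type*} [MeasurableSpace A] {P : Measure A} {S : A → ℂ}
    (hS : Measurable S) {v : ℝ≥0} (h : P.map S = cscg v) {f : ℂ → ℝ} (hf : Measurable f) :
    ∫ a, f (S a) ∂P = ∫ z, f z ∂cscg v := by
  rw [← h, integral_map hS.aemeasurable hf.aestronglyMeasurable]

lemma sq_toReal_eLpNorm_two {A : Type*} [MeasurableSpace A] {P : Measure A} {f : A → ℂ}
    (hf : MemLp f 2 P) : (eLpNorm f 2 P).toReal ^ 2 = ∫ a, ‖f a‖ ^ 2 ∂P := by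
  have h0 : 0 ≤ ∫ a, ‖f a‖ ^ 2 ∂P := integral_nonneg fun a => by positivity
  rw [hf.eLpNorm_eq_integral_rpow_norm (by simp) (by simp)]
  simp only [ENNReal.toReal_ofNat, Real.rpow_ofNat]
  rw [ENNReal.toReal_ofReal (by positivity), ← Real.rpow_natCast, ← Real.rpow_mul h0]
  norm_num

lemma integrable_inner_of_memLp_two {A : Type*} [MeasurableSpace A] {P : Measure A} {f g : A → ℂ}
    (hf : MemLp f 2 P) (hg : MemLp g 2 P) : Integrable (fun a => inner ℝ (f a) (g a)) P := by
  refine (hf.norm.integrable_mul hg.norm).mono (hf.1.inner hg.1)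
    (Filter.Eventually.of_forall fun a => ?_)
  simpa using abs_real_inner_le_norm (f a) (g a)

lemma integral_inner_le_sqrt_mul_sqrt {A : Type*} [MeasurableSpace A] {P : Measure A} {f g : A → ℂ}
    (hf : MemLp f 2 P) (hg : MemLp g 2 P) :
    ∫ a, inner ℝ (f a) (g a) ∂P ≤ √(∫ a, ‖f a‖ ^ 2 ∂P) * √(∫ a, ‖g a‖ ^ 2 ∂P) := by
  have h := integral_mul_norm_le_Lp_mul_Lq (p := 2) (q := 2) (μ := P) (f := f) (g := g)
    (by rw [Real.holderConjugate_iff]; norm_num) (by simpa using hf) (by simpa using hg)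
  rw [Real.sqrt_eq_rpow, Real.sqrt_eq_rpow]
  simp only [Real.rpow_ofNat] at h
  refine le_trans ?_ h
  exact integral_mono (integrable_inner_of_memLp_two hf hg) (hf.norm.integrable_mul hg.norm)
    fun a => real_inner_le_norm _ _

/-- A mean-square limit of CSCG variables has the Gaussian transform of a CSCG variable. -/
lemma integral_exp_neg_of_cscg_approx {A : Type*} [MeasurableSpace A] {P : Measure A}
    [IsProbabilityMeasure P] {U : A → ℂ} (hU : Measurable U)
    (h : ∀ ε : ℝ≥0∞, 0 < ε → ∃ S : A → ℂ, Measurable S ∧ (∃ v, P.map S = cscg v) ∧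
      eLpNorm (U - S) 2 P ≤ ε) :
    MemLp U 2 P ∧ ∀ {a : ℝ}, 0 < a → ∀ y : ℂ,
      ∫ x, Real.exp (-(‖y - U x‖ ^ 2 / a)) ∂P =
        a / (a + ∫ x, ‖U x‖ ^ 2 ∂P) * Real.exp (-(‖y‖ ^ 2 / (a + ∫ x, ‖U x‖ ^ 2 ∂P))) := by
  have hpos : ∀ n : ℕ, (0 : ℝ≥0∞) < ((n : ℝ≥0∞) + 1)⁻¹ := fun n =>
    ENNReal.inv_pos.2 (by simp)
  choose S hS hSv hSU using fun n : ℕ => h _ (hpos n)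
  choose v hv using hSv
  have hSL : ∀ n, MemLp (S n) 2 P := fun n => memLp_two_of_map_eq_cscg (hS n) (hv n)
  have hUL : MemLp U 2 P := by
    have h1 : MemLp (U - S 0) 2 P :=
      ⟨(hU.sub (hS 0)).aestronglyMeasurable, (hSU 0).trans_lt (by simp)⟩
    simpa using h1.add (hSL 0)
  refine ⟨hUL, fun {a} ha y => ?_⟩
  have hlim0 : Filter.Tendsto (fun n : ℕ => ((n : ℝ≥0∞) + 1)⁻¹) Filter.atTop (nhds 0) := by
    have := (Filter.tendsto_add_atTop_iff_nat 1).2 ENNReal.tendsto_inv_nat_nhds_zero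
    simpa using this
  have hlim : Filter.Tendsto (fun n => eLpNorm (S n - U) 2 P) Filter.atTop (nhds 0) := by
    refine tendsto_of_tendsto_of_tendsto_of_le_of_le tendsto_const_nhds hlim0
      (fun _ => zero_le) fun n => ?_
    change eLpNorm (S n - U) 2 P ≤ _
    rw [eLpNorm_sub_comm]
    exact hSU n
  have hv' : ∀ n, ((v n : ℝ≥0) : ℝ) = ∫ x, ‖S n x‖ ^ 2 ∂P := fun n => by
    rw [integral_comp_of_map_eq_cscg (hS n) (hv n) (f := fun z => ‖z‖ ^ 2) (by fun_prop),
      integral_norm_sq_cscg]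
  have hvlim : Filter.Tendsto (fun n => (v n : ℝ)) Filter.atTop (nhds (∫ x, ‖U x‖ ^ 2 ∂P)) := by
    have h1 := (((Lp.tendsto_Lp_iff_tendsto_eLpNorm'' S hSL U hUL).2 hlim).norm).pow 2
    simp only [Lp.norm_toLp] at h1
    rw [sq_toReal_eLpNorm_two hUL] at h1
    refine h1.congr fun n => ?_
    rw [sq_toReal_eLpNorm_two (hSL n), hv']
  -- Mean-square convergence gives almost everywhere convergence along a subsequence, which is
  -- enough to identify the limit by dominated convergence.
  obtain ⟨ns, hns, hae⟩ := (tendstoInMeasure_of_tendsto_eLpNorm (by simp)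
    (fun n => (hS n).aestronglyMeasurable) hU.aestronglyMeasurable hlim).exists_seq_tendsto_ae
  have hdct : Filter.Tendsto (fun n => ∫ x, Real.exp (-(‖y - S (ns n) x‖ ^ 2 / a)) ∂P)
      Filter.atTop (nhds (∫ x, Real.exp (-(‖y - U x‖ ^ 2 / a)) ∂P)) := by
    refine tendsto_integral_of_dominated_convergence (fun _ => 1) (fun n => ?_)
      (integrable_const _) (fun n => ?_) ?_
    · have := hS (ns n)
      exact (by fun_prop : Measurable _).aestronglyMeasurable
    · refine Filter.Eventually.of_forall fun x => ?_
      rw [Real.norm_of_nonneg (Real.exp_nonneg _), Real.exp_le_one_iff, neg_nonpos]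
      positivity
    · filter_upwards [hae] with x hx
      have hc : Continuous fun u : ℂ => Real.exp (-(‖y - u‖ ^ 2 / a)) := by fun_prop
      exact (hc.tendsto _).comp hx
  have hV : 0 ≤ ∫ x, ‖U x‖ ^ 2 ∂P := integral_nonneg fun a => by positivity
  refine tendsto_nhds_unique hdct ?_
  have hc : ContinuousAt (fun V : ℝ => a / (a + V) * Real.exp (-(‖y‖ ^ 2 / (a + V))))
      (∫ x, ‖U x‖ ^ 2 ∂P) := by
    have : a + ∫ x, ‖U x‖ ^ 2 ∂P ≠ 0 := by positivity
    fun_prop (disch := assumption)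
  refine (hc.tendsto.comp (hvlim.comp hns.tendsto_atTop)).congr fun n => ?_
  simp only [Function.comp]
  rw [integral_comp_of_map_eq_cscg (hS (ns n)) (hv (ns n))
    (f := fun z => Real.exp (-(‖y - z‖ ^ 2 / a))) (by fun_prop),
    integral_exp_neg_norm_sub_sq_cscg _ ha]

/-! ### Closed form of the auxiliary log-likelihood ratio. -/

namespace ForwardModel

variable {𝒮 : Type*} [MeasurableSpace 𝒮] {Pol : 𝒮 → ℝ≥0}

lemma measurable_X_apply (F : ForwardModel Pol) (s : 𝒮) : Measurable (F.X s) :=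
  F.measurable_X.comp measurable_prodMk_left

/-- The signal part `gain h * Xbar h` of the auxiliary model. -/
def signal (F : ForwardModel Pol) (h : ℂ) (a : F.A) : ℂ := F.gain h * F.Xbar h a

lemma measurable_signal (F : ForwardModel Pol) (h : ℂ) : Measurable (F.signal h) :=
  (F.measurable_Xbar h).const_mul _

/-- The power of the signal part of the auxiliary model. -/
def signalPower (F : ForwardModel Pol) (h : ℂ) : ℝ := ∫ a, ‖F.signal h a‖ ^ 2 ∂F.P

lemma signalPower_nonneg (F : ForwardModel Pol) (h : ℂ) : 0 ≤ F.signalPower h :=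
  integral_nonneg fun _ => by positivity

lemma exists_cscg_signal_approx (F : ForwardModel Pol) (h : ℂ) (ε : ℝ≥0∞) (hε : 0 < ε) :
    ∃ S : F.A → ℂ, Measurable S ∧ (∃ v, F.P.map S = cscg v) ∧
      eLpNorm (F.signal h - S) 2 F.P ≤ ε := by
  -- The `+ 1` avoids dividing by zero when the gain vanishes.
  have hε' : 0 < ε / (‖F.gain h‖ₑ + 1) :=
    ENNReal.div_pos hε.ne' (by simp)
  obtain ⟨w, hw⟩ := F.linear_Xbar h _ hε'
  obtain ⟨v, hv⟩ := F.jointlyCSCG w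
  have hm : Measurable fun a => w.sum fun s c => c * F.X s a := by
    unfold Finsupp.sum
    exact Finset.measurable_sum _ fun s _ => (F.measurable_X_apply s).const_mul _
  refine ⟨fun a => F.gain h * w.sum fun s c => c * F.X s a, hm.const_mul _,
    ⟨‖F.gain h‖₊ ^ 2 * v, ?_⟩, ?_⟩
  · rw [← map_const_mul_cscg v (F.gain h), ← hv, Measure.map_map (by fun_prop) hm]
    rfl
  · have : F.signal h - (fun a => F.gain h * w.sum fun s c => c * F.X s a) =
        F.gain h • fun a => F.Xbar h a - w.sum fun s c => c * F.X s a := by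
      ext a; simp [signal, mul_sub]
    rw [this, eLpNorm_const_smul]
    calc ‖F.gain h‖ₑ * _ ≤ (‖F.gain h‖ₑ + 1) * (ε / (‖F.gain h‖ₑ + 1)) := by
          gcongr; simp
      _ ≤ ε := ENNReal.mul_div_le

lemma memLp_signal (F : ForwardModel Pol) (h : ℂ) : MemLp (F.signal h) 2 F.P :=
  (integral_exp_neg_of_cscg_approx (F.measurable_signal h) (F.exists_cscg_signal_approx h)).1

lemma integral_exp_neg_signal (F : ForwardModel Pol) (h : ℂ) {a : ℝ} (ha : 0 < a) (y : ℂ) :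
    ∫ x, Real.exp (-(‖y - F.signal h x‖ ^ 2 / a)) ∂F.P =
      a / (a + F.signalPower h) * Real.exp (-(‖y‖ ^ 2 / (a + F.signalPower h))) :=
  (integral_exp_neg_of_cscg_approx (F.measurable_signal h) (F.exists_cscg_signal_approx h)).2 ha y

/-- The prefactor of the density, raised to the power `t`, cancels in the ratio; what remains of `t`
is the replacement of the noise variance by `noiseVar h / t`. -/
lemma log_q_rpow_div_qOut (F : ForwardModel Pol) {t : ℝ} (ht : 0 < t) (h y : ℂ) (a : F.A) :
    Real.log (F.q h y a ^ t / F.qOut t h y) =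
      Real.log (1 + F.signalPower h / (F.noiseVar h / t)) +
        ‖y‖ ^ 2 / (F.noiseVar h / t + F.signalPower h) -
        ‖y - F.signal h a‖ ^ 2 / (F.noiseVar h / t) := by
  have hσ := F.noiseVar_pos h
  have hV := F.signalPower_nonneg h
  have hqdef : ∀ a, F.q h y a = 1 / (Real.pi * F.noiseVar h) *
      Real.exp (-(‖y - F.gain h * F.Xbar h a‖ ^ 2 / F.noiseVar h)) := fun _ => rfl
  set V := F.signalPower h
  generalize F.noiseVar h = σ at *
  have hb : 0 < σ / t := by positivity
  have hq : ∀ a, F.q h y a ^ t =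
      (1 / (Real.pi * σ)) ^ t * Real.exp (-(‖y - F.signal h a‖ ^ 2 / (σ / t))) := by
    intro a
    rw [hqdef, Real.mul_rpow (by positivity) (Real.exp_nonneg _), ← Real.exp_mul]
    congr 2
    rw [signal]
    field_simp
  have hk : 0 < (1 / (Real.pi * σ)) ^ t := by positivity
  unfold qOut
  simp_rw [hq]
  rw [integral_const_mul, F.integral_exp_neg_signal h hb, mul_div_mul_left _ _ hk.ne',
    Real.log_div (by positivity) (by positivity), Real.log_mul (by positivity) (by positivity),
    Real.log_exp, Real.log_exp]
  have : 1 + V / (σ / t) = (σ / t / (σ / t + V))⁻¹ := by field_simp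
  rw [this, Real.log_inv]
  ring

end ForwardModel

lemma memLp_sqrt_of_integrable {𝒮 : Type*} [MeasurableSpace 𝒮] {Pol : 𝒮 → ℝ≥0} {ρ : Measure 𝒮}
    (hPol : Measurable Pol)
    (hint : Integrable (fun s => (Pol s : ℝ)) ρ) :
    MemLp (fun s => √(Pol s : ℝ)) 2 ρ := by
  rw [memLp_two_iff_integrable_sq (by fun_prop)]
  simpa using hint

namespace ForwardModel

variable {𝒮 : Type*} [MeasurableSpace 𝒮] {Pol : 𝒮 → ℝ≥0}

/-! ### Second-order statistics of the channel output -/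

lemma measurable_input (F : ForwardModel Pol) :
    Measurable fun p : F.A × 𝒮 × ℂ => F.X p.2.1 p.1 :=
  F.measurable_X.comp ((measurable_fst.comp measurable_snd).prodMk measurable_fst)

lemma lintegral_enorm_sq_X (F : ForwardModel Pol) (s : 𝒮) :
    ∫⁻ a, ‖F.X s a‖ₑ ^ 2 ∂F.P = Pol s := by
  rw [← lintegral_enorm_sq_cscg, ← F.law_X s,
    lintegral_map (by fun_prop) (F.measurable_X_apply s)]

lemma memLp_X (F : ForwardModel Pol) (s : 𝒮) : MemLp (F.X s) 2 F.P :=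
  memLp_two_of_map_eq_cscg (F.measurable_X_apply s) (F.law_X s)

lemma integral_norm_sq_X (F : ForwardModel Pol) (s : 𝒮) :
    ∫ a, ‖F.X s a‖ ^ 2 ∂F.P = Pol s := by
  rw [integral_comp_of_map_eq_cscg (F.measurable_X_apply s) (F.law_X s)
    (f := fun z => ‖z‖ ^ 2) (by fun_prop), integral_norm_sq_cscg]

variable (F : ForwardModel Pol) (ρ : Measure 𝒮) [IsProbabilityMeasure ρ]

/-- The law of `(A, S_T, Z)` when `S_T ∼ ρ`. -/
def law : Measure (F.A × 𝒮 × ℂ) := F.P.prod (ρ.prod (cscg 1))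

instance : IsProbabilityMeasure (F.law ρ) := by unfold law; infer_instance

lemma lintegral_enorm_sq_input (hPol : Measurable Pol) :
    ∫⁻ p, ‖F.X p.2.1 p.1‖ₑ ^ 2 ∂F.law ρ = ∫⁻ s, Pol s ∂ρ := by
  have hm := F.measurable_input
  rw [law, lintegral_prod_symm _ (hm.enorm.pow_const 2).aemeasurable]
  simp_rw [F.lintegral_enorm_sq_X]
  rw [lintegral_prod _ (by fun_prop)]
  simp

variable {ρ}

lemma memLp_input (hPol : Measurable Pol) (hint : Integrable (fun s => (Pol s : ℝ)) ρ) :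
    MemLp (fun p : F.A × 𝒮 × ℂ => F.X p.2.1 p.1) 2 (F.law ρ) := by
  refine ⟨F.measurable_input.aestronglyMeasurable, ?_⟩
  rw [eLpNorm_lt_top_iff_lintegral_rpow_enorm_lt_top (by simp) (by simp)]
  simp only [ENNReal.toReal_ofNat, ENNReal.rpow_ofNat]
  rw [F.lintegral_enorm_sq_input ρ hPol]
  have := hint.2
  simpa [HasFiniteIntegral] using this

lemma integral_norm_sq_input (hPol : Measurable Pol) (hint : Integrable (fun s => (Pol s : ℝ)) ρ) :
    ∫ p, ‖F.X p.2.1 p.1‖ ^ 2 ∂F.law ρ = ∫ s, (Pol s : ℝ) ∂ρ := by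
  have hi := (F.memLp_input hPol hint).integrable_norm_pow (by simp)
  rw [law, integral_prod_symm _ hi]
  simp_rw [F.integral_norm_sq_X]
  exact (integral_fun_fst (f := fun s => (Pol s : ℝ))).trans (by simp)

lemma memLp_noise : MemLp (fun p : F.A × 𝒮 × ℂ => p.2.2) 2 (F.law ρ) :=
  ((memLp_two_id_cscg 1).comp_snd ρ).comp_snd F.P

lemma memLp_signal_law (h : ℂ) : MemLp (fun p : F.A × 𝒮 × ℂ => F.signal h p.1) 2 (F.law ρ) :=
  (F.memLp_signal h).comp_fst _

lemma integral_norm_sq_noise : ∫ p, ‖p.2.2‖ ^ 2 ∂F.law ρ = 1 := by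
  rw [law, integral_fun_snd (f := fun p : 𝒮 × ℂ => ‖p.2‖ ^ 2),
    integral_fun_snd (f := fun p : ℂ => ‖p‖ ^ 2), integral_norm_sq_cscg]
  simp

/-- The noise has mean zero and is independent of the symbol and the CSIT, so the innermost integral
vanishes. -/
lemma integral_inner_noise {f : F.A × 𝒮 → ℂ}
    (hf : MemLp (fun p : F.A × 𝒮 × ℂ => f (p.1, p.2.1)) 2 (F.law ρ)) :
    ∫ p, inner ℝ (f (p.1, p.2.1)) p.2.2 ∂F.law ρ = 0 := by
  have hi := integrable_inner_of_memLp_two hf F.memLp_noise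
  rw [law, integral_prod _ hi]
  refine integral_eq_zero_of_ae ?_
  filter_upwards [hi.prod_right_ae] with a ha
  rw [integral_prod _ ha]
  refine integral_eq_zero_of_ae (Filter.Eventually.of_forall fun s => ?_)
  have := integral_inner (𝕜 := ℝ) (integrable_id_cscg 1) (f (a, s))
  simpa [integral_id_cscg] using this

lemma memLp_output (hPol : Measurable Pol) (hint : Integrable (fun s => (Pol s : ℝ)) ρ) (h : ℂ) :
    MemLp (fun p : F.A × 𝒮 × ℂ => h * F.X p.2.1 p.1 + p.2.2) 2 (F.law ρ) :=
  ((F.memLp_input hPol hint).const_mul h).add F.memLp_noise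

lemma integral_norm_sq_output (hPol : Measurable Pol)
    (hint : Integrable (fun s => (Pol s : ℝ)) ρ) (h : ℂ) :
    ∫ p, ‖h * F.X p.2.1 p.1 + p.2.2‖ ^ 2 ∂F.law ρ = 1 + ‖h‖ ^ 2 * ∫ s, (Pol s : ℝ) ∂ρ := by
  have hX := (F.memLp_input hPol hint).const_mul h
  have hZ := F.memLp_noise (ρ := ρ)
  have i1 : Integrable (fun p : F.A × 𝒮 × ℂ => ‖h * F.X p.2.1 p.1‖ ^ 2) (F.law ρ) := by
    simpa using hX.integrable_norm_pow (by simp)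
  have i3 : Integrable (fun p : F.A × 𝒮 × ℂ => ‖p.2.2‖ ^ 2) (F.law ρ) := by
    simpa using hZ.integrable_norm_pow (by simp)
  have i2 := (integrable_inner_of_memLp_two hX hZ).const_mul 2
  have i12 : Integrable (fun p : F.A × 𝒮 × ℂ => ‖h * F.X p.2.1 p.1‖ ^ 2 +
    2 * inner ℝ (h * F.X p.2.1 p.1) p.2.2) (F.law ρ) := i1.add i2
  simp_rw [norm_add_sq_real]
  rw [integral_add i12 i3, integral_add i1 i2, integral_const_mul,
    F.integral_inner_noise (f := fun p => h * F.X p.2 p.1) hX, F.integral_norm_sq_noise]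
  simp_rw [norm_mul, mul_pow]
  rw [integral_const_mul, F.integral_norm_sq_input hPol hint]
  ring

lemma integral_norm_sq_signal_law (h : ℂ) :
    ∫ p, ‖F.signal h p.1‖ ^ 2 ∂F.law ρ = F.signalPower h := by
  rw [law, integral_fun_fst (f := fun a => ‖F.signal h a‖ ^ 2)]
  simp [signalPower]

/-- The real part of the correlation of the channel output with the signal part of the auxiliary
model. -/
def correlation (ρ : Measure 𝒮) (h : ℂ) : ℝ :=
  ∫ p, inner ℝ (h * F.X p.2.1 p.1) (F.signal h p.1) ∂F.law ρ

lemma integral_inner_output_signal (hPol : Measurable Pol)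
    (hint : Integrable (fun s => (Pol s : ℝ)) ρ) (h : ℂ) :
    ∫ p, inner ℝ (h * F.X p.2.1 p.1 + p.2.2) (F.signal h p.1) ∂F.law ρ = F.correlation ρ h := by
  have hX := (F.memLp_input hPol hint).const_mul h
  have hU := F.memLp_signal_law (ρ := ρ) h
  simp_rw [inner_add_left]
  rw [integral_add (integrable_inner_of_memLp_two hX hU)
    (integrable_inner_of_memLp_two F.memLp_noise hU)]
  have : ∫ p : F.A × 𝒮 × ℂ, inner ℝ p.2.2 (F.signal h p.1) ∂F.law ρ = 0 := by
    simp_rw [fun p : F.A × 𝒮 × ℂ => real_inner_comm (F.signal h p.1) p.2.2]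
    exact F.integral_inner_noise (f := fun p => F.signal h p.1) hU
  rw [this, add_zero, correlation]

/-- Cauchy–Schwarz is applied over the symbol with the CSIT value held fixed, and only then
averaged. This produces the mean of `√P`; the reverse order would give the weaker square root of the
mean of `P`. -/
lemma correlation_le (hPol : Measurable Pol)
    (hint : Integrable (fun s => (Pol s : ℝ)) ρ) (h : ℂ) :
    F.correlation ρ h ≤ ‖h‖ * (∫ s, √(Pol s : ℝ) ∂ρ) * √(F.signalPower h) := by
  have hX := (F.memLp_input hPol hint).const_mul h
  have hi := integrable_inner_of_memLp_two hX (F.memLp_signal_law (ρ := ρ) h)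
  have hs := (memLp_sqrt_of_integrable hPol hint).integrable one_le_two
  rw [correlation, law, integral_prod_symm _ hi]
  calc ∫ q : 𝒮 × ℂ, ∫ a, inner ℝ (h * F.X q.1 a) (F.signal h a) ∂F.P ∂(ρ.prod (cscg 1))
      ≤ ∫ q : 𝒮 × ℂ, ‖h‖ * √(Pol q.1 : ℝ) * √(F.signalPower h) ∂(ρ.prod (cscg 1)) := by
        refine integral_mono hi.integral_prod_right
          (((hs.const_mul _).mul_const _).comp_fst (cscg 1)) fun q => ?_
        refine (integral_inner_le_sqrt_mul_sqrt ((F.memLp_X q.1).const_mul h)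
          (F.memLp_signal h)).trans_eq ?_
        simp_rw [norm_mul, mul_pow]
        rw [integral_const_mul, F.integral_norm_sq_X, Real.sqrt_mul (by positivity),
          Real.sqrt_sq (norm_nonneg _)]
        rfl
    _ = _ := by
        rw [integral_fun_fst (f := fun s => ‖h‖ * √(Pol s : ℝ) * √(F.signalPower h)),
          integral_mul_const, integral_const_mul]
        simp

lemma gmiAt_eq (hPol : Measurable Pol) {κ : Kernel ℂ 𝒮} [IsMarkovKernel κ] {h : ℂ}
    (hint : Integrable (fun s => (Pol s : ℝ)) (κ h)) {t : ℝ} (ht : 0 < t) :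
    F.gmiAt κ t h =
      Real.log (1 + F.signalPower h / (F.noiseVar h / t)) +
        (1 + ‖h‖ ^ 2 * ∫ s, (Pol s : ℝ) ∂κ h) / (F.noiseVar h / t + F.signalPower h) -
        (1 + ‖h‖ ^ 2 * (∫ s, (Pol s : ℝ) ∂κ h) - 2 * F.correlation (κ h) h + F.signalPower h) /
          (F.noiseVar h / t) := by
  have hY := F.memLp_output hPol hint h
  have hU := F.memLp_signal_law (ρ := κ h) h
  have iY : Integrable (fun p : F.A × 𝒮 × ℂ => ‖h * F.X p.2.1 p.1 + p.2.2‖ ^ 2)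
      (F.law (κ h)) := by
    simpa using hY.integrable_norm_pow (by simp)
  have iU : Integrable (fun p : F.A × 𝒮 × ℂ => ‖F.signal h p.1‖ ^ 2) (F.law (κ h)) := by
    simpa using hU.integrable_norm_pow (by simp)
  have iYU := (integrable_inner_of_memLp_two hY hU).const_mul 2
  change ∫ p, _ ∂F.law (κ h) = _
  simp_rw [F.log_q_rpow_div_qOut ht, norm_sub_sq_real]
  have iS : Integrable (fun p : F.A × 𝒮 × ℂ => ‖h * F.X p.2.1 p.1 + p.2.2‖ ^ 2 -
    2 * inner ℝ (h * F.X p.2.1 p.1 + p.2.2) (F.signal h p.1)) (F.law (κ h)) := iY.sub iYU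
  have iD : Integrable (fun p : F.A × 𝒮 × ℂ => ‖h * F.X p.2.1 p.1 + p.2.2‖ ^ 2 -
    2 * inner ℝ (h * F.X p.2.1 p.1 + p.2.2) (F.signal h p.1) + ‖F.signal h p.1‖ ^ 2)
    (F.law (κ h)) := iS.add iU
  have iC : Integrable (fun p : F.A × 𝒮 × ℂ =>
    Real.log (1 + F.signalPower h / (F.noiseVar h / t)) + ‖h * F.X p.2.1 p.1 + p.2.2‖ ^ 2 /
      (F.noiseVar h / t + F.signalPower h)) (F.law (κ h)) :=
    (integrable_const _).add (iY.div_const _)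
  rw [integral_sub iC (iD.div_const _),
    integral_add (integrable_const _) (iY.div_const _), integral_div, integral_div,
    integral_add iS iU, integral_sub iY iYU, integral_const_mul,
    F.integral_norm_sq_output hPol hint, F.integral_inner_output_signal hPol hint,
    F.integral_norm_sq_signal_law]
  simp

end ForwardModel

/-! ### Upper bound on the GMI for a fixed fading value. -/

lemma variance_sqrt_eq {𝒮 : Type*} [MeasurableSpace 𝒮] {Pol : 𝒮 → ℝ≥0} {ρ : Measure 𝒮}
    [IsProbabilityMeasure ρ] (hPol : Measurable Pol)
    (hint : Integrable (fun s => (Pol s : ℝ)) ρ) :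
    variance (fun s => √(Pol s : ℝ)) ρ = (∫ s, (Pol s : ℝ) ∂ρ) - (∫ s, √(Pol s : ℝ) ∂ρ) ^ 2 := by
  rw [variance_eq_sub (memLp_sqrt_of_integrable hPol hint)]
  simp

/-- The gap in `log (1 + v / a) + … ≤ log (1 + SNR)`: `e` is the output power, `c` the largest
normalised correlation. -/
lemma log_add_sub_le {a v e c r : ℝ} (ha : 0 < a) (hv : 0 ≤ v) (he : c ^ 2 < e)
    (hr : r ≤ c * √v) :
    Real.log (1 + v / a) + e / (a + v) - (e - 2 * r + v) / a ≤
      Real.log (1 + c ^ 2 / (e - c ^ 2)) := by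
  have he0 : 0 < e := (sq_nonneg c).trans_lt he
  have hd : 0 < e - c ^ 2 := sub_pos.2 he
  have h1 : 1 + c ^ 2 / (e - c ^ 2) = (1 - c ^ 2 / e)⁻¹ := by field_simp; ring
  have h2 : 0 < 1 - c ^ 2 / e := by
    have : 1 - c ^ 2 / e = (e - c ^ 2) / e := by field_simp
    rw [this]; positivity
  have h3 : 0 < 1 + v / a := by positivity
  -- The tangent inequality is applied to the product `(1 + v/a) (1 - c²/e)`, whose logarithm is the
  -- difference of the two logarithms to be compared; it is tight when that product is one.
  have h4 := Real.log_le_sub_one_of_pos (mul_pos h3 h2)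
  rw [Real.log_mul h3.ne' h2.ne'] at h4
  rw [h1, Real.log_inv]
  have hw : √v ^ 2 = v := Real.sq_sqrt hv
  -- At the extremal correlation `r = c √v` the remaining gap is minus a perfect square.
  have key : (1 + v / a) * (1 - c ^ 2 / e) - 1 + e / (a + v) - (e - 2 * (c * √v) + v) / a =
      -((c * (a + v) - e * √v) ^ 2 / (a * e * (a + v))) := by
    have : 0 < a + v := by positivity
    generalize √v = w at hw
    subst hw
    field_simp
    ring
  have hq : 0 ≤ (c * (a + v) - e * √v) ^ 2 / (a * e * (a + v)) := by positivity
  have hrr : (e - 2 * (c * √v) + v) / a ≤ (e - 2 * r + v) / a := by gcongr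
  linarith

lemma snr_nonneg {𝒮 : Type*} [MeasurableSpace 𝒮] (κ : Kernel ℂ 𝒮) (Pol : 𝒮 → ℝ≥0) (h : ℂ) :
    0 ≤ snr κ Pol h := by
  have := variance_nonneg (fun s => √(Pol s : ℝ)) (κ h)
  unfold snr; positivity

namespace ForwardModel

variable {𝒮 : Type*} [MeasurableSpace 𝒮] {Pol : 𝒮 → ℝ≥0} (F : ForwardModel Pol)

lemma snr_eq (hPol : Measurable Pol) {κ : Kernel ℂ 𝒮} [IsMarkovKernel κ] {h : ℂ}
    (hint : Integrable (fun s => (Pol s : ℝ)) (κ h)) :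
    snr κ Pol h = (‖h‖ * ∫ s, √(Pol s : ℝ) ∂κ h) ^ 2 /
      (1 + ‖h‖ ^ 2 * (∫ s, (Pol s : ℝ) ∂κ h) - (‖h‖ * ∫ s, √(Pol s : ℝ) ∂κ h) ^ 2) := by
  rw [snr, variance_sqrt_eq hPol hint]
  congr 1 <;> ring

lemma sq_lt_output_power (hPol : Measurable Pol) {κ : Kernel ℂ 𝒮} [IsMarkovKernel κ] {h : ℂ}
    (hint : Integrable (fun s => (Pol s : ℝ)) (κ h)) :
    (‖h‖ * ∫ s, √(Pol s : ℝ) ∂κ h) ^ 2 < 1 + ‖h‖ ^ 2 * ∫ s, (Pol s : ℝ) ∂κ h := by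
  have h1 := variance_nonneg (fun s => √(Pol s : ℝ)) (κ h)
  rw [variance_sqrt_eq hPol hint] at h1
  nlinarith [mul_nonneg (sq_nonneg ‖h‖) h1]

lemma gmiAt_le (hPol : Measurable Pol) {κ : Kernel ℂ 𝒮} [IsMarkovKernel κ] {h : ℂ}
    (hint : Integrable (fun s => (Pol s : ℝ)) (κ h)) {t : ℝ} (ht : 0 ≤ t) :
    F.gmiAt κ t h ≤ Real.log (1 + snr κ Pol h) := by
  rcases ht.eq_or_lt with rfl | ht
  -- At exponent zero both the numerator and the output density equal one.
  · have h0 : F.gmiAt κ 0 h = 0 := by simp [gmiAt, qOut]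
    rw [h0]
    exact Real.log_nonneg (by linarith [snr_nonneg κ Pol h])
  rw [F.gmiAt_eq hPol hint ht, snr_eq hPol hint]
  have hσ := F.noiseVar_pos h
  exact log_add_sub_le (by positivity) (F.signalPower_nonneg h)
    (sq_lt_output_power hPol hint) (F.correlation_le hPol hint h)

end ForwardModel

variable {𝒮 : Type*} [MeasurableSpace 𝒮]

/-! ### The optimal forward model -/

/-- The conditional mean of `√P(S_T)` given `H = h`. -/
def sqrtMean (κ : Kernel ℂ 𝒮) (Pol : 𝒮 → ℝ≥0) (h : ℂ) : ℝ := ∫ s, √(Pol s : ℝ) ∂κ h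

/-- The power of the noise and of the part of the signal unknown to the receiver, given `H = h`. -/
def residualPower (κ : Kernel ℂ 𝒮) (Pol : 𝒮 → ℝ≥0) (h : ℂ) : ℝ :=
  1 + ‖h‖ ^ 2 * variance (fun s => √(Pol s : ℝ)) (κ h)

lemma residualPower_pos (κ : Kernel ℂ 𝒮) (Pol : 𝒮 → ℝ≥0) (h : ℂ) : 0 < residualPower κ Pol h := by
  have := variance_nonneg (fun s => √(Pol s : ℝ)) (κ h)
  unfold residualPower; positivity

/-- This makes the common Gaussian `W` an admissible auxiliary input: dividing one entry of nonzero
power by `√P(s)` recovers it. If every power is zero, all entries vanish and only the zero input is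
linear in them. -/
lemma exists_weights_of_sqrt_mul {𝒮 : Type*} (Pol : 𝒮 → ℝ≥0) [Decidable (∃ s, Pol s ≠ 0)] :
    ∃ w : 𝒮 →₀ ℂ, ∀ a : ℂ, (if ∃ s, Pol s ≠ 0 then a else 0) =
      w.sum fun s c => c * ((√(Pol s : ℝ) : ℝ) * a) := by
  by_cases hs : ∃ s, Pol s ≠ 0
  · obtain ⟨s, hs'⟩ := hs
    refine ⟨Finsupp.single s ((√(Pol s : ℝ) : ℝ) : ℂ)⁻¹, fun a => ?_⟩
    have h0 : ((√(Pol s : ℝ) : ℝ) : ℂ) ≠ 0 := by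
      rw [Complex.ofReal_ne_zero]
      have : 0 < Pol s := pos_iff_ne_zero.2 hs'
      positivity
    rw [if_pos ⟨s, hs'⟩, Finsupp.sum_single_index (by simp)]
    field_simp
  · exact ⟨0, fun a => by simp [hs]⟩

open Classical in
/-- The adaptive symbol `X(s) = √P(s) W` with `W ∼ 𝒞𝒩(0, 1)`, with the linear minimum mean-square
error model for the channel output. -/
def optimalModel (κ : Kernel ℂ 𝒮) {Pol : 𝒮 → ℝ≥0} (hPol : Measurable Pol) : ForwardModel Pol where
  A := ℂ
  P := cscg 1
  X s a := (√(Pol s : ℝ) : ℝ) * a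
  measurable_X := by
    change Measurable fun p : 𝒮 × ℂ => ((√(Pol p.1 : ℝ) : ℝ) : ℂ) * p.2
    fun_prop
  jointlyCSCG w := by
    refine ⟨_, Eq.trans ?_ (map_const_mul_cscg 1 (w.sum fun s c => c * (√(Pol s : ℝ) : ℝ)))⟩
    congr 1
    ext a
    simp only [Finsupp.sum, Finset.sum_mul, mul_assoc]
  law_X s := by
    rw [map_const_mul_cscg]
    congr 1
    ext
    simp [Real.sq_sqrt]
  Xbar _ a := if ∃ s, Pol s ≠ 0 then a else 0
  measurable_Xbar _ := by split_ifs <;> fun_prop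
  linear_Xbar h ε _ := by
    obtain ⟨w, hw⟩ := exists_weights_of_sqrt_mul Pol
    refine ⟨w, ?_⟩
    simp [hw]
  gain h := h * (sqrtMean κ Pol h : ℝ)
  noiseVar := residualPower κ Pol
  noiseVar_pos := residualPower_pos κ Pol

open Classical in
lemma optimalModel_signal (κ : Kernel ℂ 𝒮) {Pol : 𝒮 → ℝ≥0} (hPol : Measurable Pol) (h : ℂ) :
    (optimalModel κ hPol).signal h = fun a : ℂ => h * (sqrtMean κ Pol h : ℝ) * a := by
  funext (a : ℂ)
  change h * (sqrtMean κ Pol h : ℝ) * (if ∃ s, Pol s ≠ 0 then a else 0) = _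
  by_cases hs : ∃ s, Pol s ≠ 0
  · rw [if_pos hs]
  · rw [if_neg hs]
    push Not at hs
    simp [sqrtMean, hs]

lemma optimalModel_signalPower (κ : Kernel ℂ 𝒮) {Pol : 𝒮 → ℝ≥0} (hPol : Measurable Pol) (h : ℂ) :
    (optimalModel κ hPol).signalPower h = (‖h‖ * sqrtMean κ Pol h) ^ 2 := by
  rw [ForwardModel.signalPower, optimalModel_signal]
  change ∫ a, _ ∂cscg 1 = _
  simp_rw [norm_mul, mul_pow]
  rw [integral_const_mul, integral_norm_sq_cscg]
  simp

lemma optimalModel_correlation (κ : Kernel ℂ 𝒮) [IsMarkovKernel κ] {Pol : 𝒮 → ℝ≥0}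
    (hPol : Measurable Pol) (h : ℂ) :
    (optimalModel κ hPol).correlation (κ h) h = (‖h‖ * sqrtMean κ Pol h) ^ 2 := by
  rw [ForwardModel.correlation, optimalModel_signal]
  change ∫ p : ℂ × 𝒮 × ℂ, inner ℝ (h * ((√(Pol p.2.1 : ℝ) : ℝ) * p.1))
    (h * (sqrtMean κ Pol h : ℝ) * p.1) ∂((cscg 1).prod ((κ h).prod (cscg 1))) = _
  have key : ∀ p : ℂ × 𝒮 × ℂ, inner ℝ (h * ((√(Pol p.2.1 : ℝ) : ℝ) * p.1))
      (h * (sqrtMean κ Pol h : ℝ) * p.1) =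
      (‖h‖ ^ 2 * sqrtMean κ Pol h) * (‖p.1‖ ^ 2 * √(Pol p.2.1 : ℝ)) := by
    intro p
    rw [Complex.sq_norm, Complex.sq_norm, Complex.normSq_apply, Complex.normSq_apply]
    simp [Complex.inner]
    ring
  simp_rw [key]
  rw [integral_const_mul, integral_prod_mul (fun z : ℂ => ‖z‖ ^ 2)
    (fun q : 𝒮 × ℂ => √(Pol q.1 : ℝ)), integral_norm_sq_cscg,
    integral_fun_fst (f := fun s => √(Pol s : ℝ))]
  simp only [probReal_univ, one_smul, NNReal.coe_one]
  rw [← sqrtMean]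
  ring

lemma residualPower_eq {κ : Kernel ℂ 𝒮} [IsMarkovKernel κ] {Pol : 𝒮 → ℝ≥0}
    (hPol : Measurable Pol) {h : ℂ} (hint : Integrable (fun s => (Pol s : ℝ)) (κ h)) :
    residualPower κ Pol h =
      1 + ‖h‖ ^ 2 * (∫ s, (Pol s : ℝ) ∂κ h) - (‖h‖ * sqrtMean κ Pol h) ^ 2 := by
  rw [residualPower, variance_sqrt_eq hPol hint, sqrtMean]
  ring

lemma snr_eq_div_residualPower (κ : Kernel ℂ 𝒮) (Pol : 𝒮 → ℝ≥0) (h : ℂ) :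
    snr κ Pol h = (‖h‖ * sqrtMean κ Pol h) ^ 2 / residualPower κ Pol h := by
  rw [snr, residualPower, sqrtMean, mul_pow]

/-- Both variances of the model match the true ones: the output power is residual plus signal power,
and the mean square error is the residual power. The two quotients are therefore one and cancel. -/
lemma gmiAt_optimalModel {κ : Kernel ℂ 𝒮} [IsMarkovKernel κ] {Pol : 𝒮 → ℝ≥0}
    (hPol : Measurable Pol) {h : ℂ} (hint : Integrable (fun s => (Pol s : ℝ)) (κ h)) :
    (optimalModel κ hPol).gmiAt κ 1 h = Real.log (1 + snr κ Pol h) := by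
  rw [ForwardModel.gmiAt_eq _ hPol hint one_pos, optimalModel_signalPower,
    optimalModel_correlation, snr_eq_div_residualPower]
  change Real.log (1 + _ / (residualPower κ Pol h / 1)) +
    _ / (residualPower κ Pol h / 1 + _) - _ / (residualPower κ Pol h / 1) = _
  have h1 := residualPower_eq hPol hint
  have h2 := residualPower_pos κ Pol h
  set e := 1 + ‖h‖ ^ 2 * ∫ s, (Pol s : ℝ) ∂κ h
  set v := (‖h‖ * sqrtMean κ Pol h) ^ 2
  have he : e = residualPower κ Pol h + v := by linarith
  have hv : 0 ≤ v := sq_nonneg _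
  have hv' : 0 < residualPower κ Pol h + v := by positivity
  rw [he, div_one, div_self hv'.ne']
  have : residualPower κ Pol h + v - 2 * v + v = residualPower κ Pol h := by ring
  rw [this, div_self h2.ne']
  ring

/-! ### Integrability of the rate -/

lemma measurable_sqrtMean (κ : Kernel ℂ 𝒮) [IsSFiniteKernel κ] {Pol : 𝒮 → ℝ≥0}
    (hPol : Measurable Pol) : Measurable (sqrtMean κ Pol) := by
  have h : Measurable fun s => √(Pol s : ℝ) := by fun_prop
  exact (StronglyMeasurable.integral_kernel (κ := κ) h.stronglyMeasurable).measurable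

lemma measurable_residualPower (κ : Kernel ℂ 𝒮) [IsSFiniteKernel κ] {Pol : 𝒮 → ℝ≥0}
    (hPol : Measurable Pol) : Measurable (residualPower κ Pol) := by
  have hm := measurable_sqrtMean κ hPol
  have : Measurable fun h => variance (fun s => √(Pol s : ℝ)) (κ h) := by
    refine Measurable.ennreal_toReal ?_
    refine Measurable.lintegral_kernel_prod_right
      (f := fun h s => ‖√(Pol s : ℝ) - sqrtMean κ Pol h‖ₑ ^ 2) ?_
    change Measurable fun p : ℂ × 𝒮 => ‖√(Pol p.2 : ℝ) - sqrtMean κ Pol p.1‖ₑ ^ 2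
    fun_prop
  unfold residualPower
  fun_prop

lemma measurable_snr (κ : Kernel ℂ 𝒮) [IsSFiniteKernel κ] {Pol : 𝒮 → ℝ≥0}
    (hPol : Measurable Pol) : Measurable (snr κ Pol) := by
  have h1 := measurable_sqrtMean κ hPol
  have h2 := measurable_residualPower κ hPol
  have : snr κ Pol = fun h => (‖h‖ * sqrtMean κ Pol h) ^ 2 / residualPower κ Pol h :=
    funext (snr_eq_div_residualPower κ Pol)
  rw [this]
  fun_prop

/-- The product of `‖h‖ ^ 2` and the conditional mean power need not be integrable, since fading and
CSIT may be dependent. Bounding the logarithm of a product by a sum leaves only terms with finite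
mean. -/
lemma log_one_add_snr_le {κ : Kernel ℂ 𝒮} [IsMarkovKernel κ] {Pol : 𝒮 → ℝ≥0}
    (hPol : Measurable Pol) {h : ℂ} (hint : Integrable (fun s => (Pol s : ℝ)) (κ h)) :
    Real.log (1 + snr κ Pol h) ≤ ‖h‖ ^ 2 + ∫ s, (Pol s : ℝ) ∂κ h := by
  have h1 := variance_nonneg (fun s => √(Pol s : ℝ)) (κ h)
  have h2 : snr κ Pol h ≤ ‖h‖ ^ 2 * sqrtMean κ Pol h ^ 2 := by
    rw [snr_eq_div_residualPower, ← mul_pow]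
    refine div_le_self (sq_nonneg _) ?_
    rw [residualPower]
    nlinarith [mul_nonneg (sq_nonneg ‖h‖) h1]
  have h3 : sqrtMean κ Pol h ^ 2 ≤ ∫ s, (Pol s : ℝ) ∂κ h := by
    rw [variance_sqrt_eq hPol hint] at h1
    rw [sqrtMean]; linarith
  calc Real.log (1 + snr κ Pol h)
      ≤ Real.log ((1 + ‖h‖ ^ 2) * (1 + sqrtMean κ Pol h ^ 2)) := by
        refine Real.log_le_log (by linarith [snr_nonneg κ Pol h]) ?_
        nlinarith [sq_nonneg ‖h‖, sq_nonneg (sqrtMean κ Pol h)]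
    _ = Real.log (1 + ‖h‖ ^ 2) + Real.log (1 + sqrtMean κ Pol h ^ 2) :=
        Real.log_mul (by positivity) (by positivity)
    _ ≤ ‖h‖ ^ 2 + sqrtMean κ Pol h ^ 2 := by
        have a1 := Real.log_le_sub_one_of_pos (x := 1 + ‖h‖ ^ 2) (by positivity)
        have a2 := Real.log_le_sub_one_of_pos (x := 1 + sqrtMean κ Pol h ^ 2) (by positivity)
        linarith
    _ ≤ _ := by linarith

section Rate

variable {PH : Measure ℂ} [IsProbabilityMeasure PH] {κ : Kernel ℂ 𝒮} [IsMarkovKernel κ]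
  {Pol : 𝒮 → ℝ≥0}

lemma ae_integrable_pol (hint : Integrable (fun p : ℂ × 𝒮 => (Pol p.2 : ℝ)) (PH ⊗ₘ κ)) :
    ∀ᵐ h ∂PH, Integrable (fun s => (Pol s : ℝ)) (κ h) :=
  ((Measure.integrable_compProd_iff hint.1).1 hint).1

lemma integrable_log_one_add_snr (hPol : Measurable Pol)
    (hH2 : Integrable (fun h : ℂ => ‖h‖ ^ 2) PH)
    (hint : Integrable (fun p : ℂ × 𝒮 => (Pol p.2 : ℝ)) (PH ⊗ₘ κ)) :
    Integrable (fun h => Real.log (1 + snr κ Pol h)) PH := by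
  have hp : Integrable (fun h => ∫ s, (Pol s : ℝ) ∂κ h) PH := by
    simpa using ((Measure.integrable_compProd_iff hint.1).1 hint).2
  have hm := measurable_snr κ hPol
  refine (hH2.add hp).mono' (hm.const_add 1).log.aestronglyMeasurable ?_
  filter_upwards [ae_integrable_pol hint] with h hh
  rw [Real.norm_of_nonneg (Real.log_nonneg (by linarith [snr_nonneg κ Pol h]))]
  exact log_one_add_snr_le hPol hh

lemma isGreatest_forwardGMIs (hPol : Measurable Pol)
    (hH2 : Integrable (fun h : ℂ => ‖h‖ ^ 2) PH)
    (hint : Integrable (fun p : ℂ × 𝒮 => (Pol p.2 : ℝ)) (PH ⊗ₘ κ)) :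
    IsGreatest (forwardGMIs PH κ Pol) (∫ h, Real.log (1 + snr κ Pol h) ∂PH) := by
  have hi := integrable_log_one_add_snr hPol hH2 hint
  constructor
  · have heq : (fun h => Real.log (1 + snr κ Pol h)) =ᵐ[PH] (optimalModel κ hPol).gmiAt κ 1 := by
      filter_upwards [ae_integrable_pol hint] with h hh
      exact (gmiAt_optimalModel hPol hh).symm
    exact ⟨optimalModel κ hPol, 1, zero_le_one, hi.congr heq, integral_congr_ae heq⟩
  · rintro r ⟨F, t, ht, hF, rfl⟩
    refine integral_mono_ae hF hi ?_
    filter_upwards [ae_integrable_pol hint] with h hh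
    exact F.gmiAt_le hPol hh ht

end Rate

/-! ### Random coding with a threshold decoder -/

section WeakLaw

variable {T : Type*} [MeasurableSpace T] {ρ : Measure T} [IsProbabilityMeasure ρ]

/-- Weak law of large numbers, lower tail, for an integrable function of i.i.d. variables. -/
lemma tendsto_measure_pi_sum_lt {J : T → ℝ} (hJm : Measurable J) (hJ : Integrable J ρ) {c : ℝ}
    (hc : c < ∫ x, J x ∂ρ) :
    Filter.Tendsto (fun n : ℕ => Measure.pi (fun _ : Fin n => ρ) {x | ∑ i, J (x i) < n * c})
      Filter.atTop (nhds 0) := by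
  -- The strong law is applied on one space of infinite sequences, whose first `n` coordinates have
  -- the finite product law.
  let PN : Measure (ℕ → T) := Measure.infinitePi fun _ => ρ
  have hmp : ∀ i : ℕ, MeasurePreserving (Function.eval i) PN ρ := fun i =>
    measurePreserving_eval_infinitePi (fun _ : ℕ => ρ) i
  have hlaw : ∀ i : ℕ, PN.map (fun ω => J (ω i)) = ρ.map J := fun i => by
    rw [← (hmp i).map_eq, Measure.map_map hJm (hmp i).measurable]; rfl
  have hJi : ∀ i : ℕ, Measurable fun ω : ℕ → T => J (ω i) := fun i =>
    hJm.comp (measurable_pi_apply i)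
  have hint : ∀ i : ℕ, Integrable (fun ω => J (ω i)) PN := fun i =>
    (hmp i).integrable_comp_of_integrable hJ
  have hmean : ∫ ω, J (ω 0) ∂PN = ∫ x, J x ∂ρ := by
    rw [← integral_map (φ := fun ω : ℕ → T => J (ω 0)) (f := fun x : ℝ => x) (hJi 0).aemeasurable
      (by fun_prop), hlaw, integral_map hJm.aemeasurable (by fun_prop)]
  have hslln := strong_law_ae_real (fun (i : ℕ) (ω : ℕ → T) => J (ω i)) (hint 0)
    (fun i j hij => (iIndepFun_infinitePi (P := fun _ : ℕ => ρ) (X := fun _ => J)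
      fun _ => hJm).indepFun hij)
    fun i => ⟨(hJi i).aemeasurable, (hJi 0).aemeasurable, by rw [hlaw, hlaw]⟩
  rw [hmean] at hslln
  have htm := tendstoInMeasure_of_tendsto_ae
    (fun n => (by fun_prop : Measurable fun ω : ℕ → T =>
      (∑ i ∈ Finset.range n, J (ω i)) / n).aestronglyMeasurable) hslln
  rw [tendstoInMeasure_iff_dist] at htm
  refine tendsto_of_tendsto_of_tendsto_of_le_of_le' tendsto_const_nhds
    (htm (∫ x, J x ∂ρ - c) (sub_pos.2 hc)) (Filter.Eventually.of_forall fun _ => zero_le) ?_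
  filter_upwards [Filter.eventually_gt_atTop 0] with n hn
  have hn' : (0 : ℝ) < n := by exact_mod_cast hn
  have hpi : Measure.pi (fun _ : Fin n => ρ) = PN.map fun ω (i : Fin n) => ω i := by
    rw [Measure.map_infinitePi_infinitePi_of_inj (P := fun _ : ℕ => ρ) Fin.val_injective,
      Measure.infinitePi_eq_pi]
  rw [hpi, Measure.map_apply (by fun_prop)
    (measurableSet_lt (by fun_prop) measurable_const)]
  refine measure_mono fun ω hω => ?_
  simp only [Set.mem_preimage, Set.mem_ofPred_eq] at hω ⊢
  rw [Fin.sum_univ_eq_sum_range (fun i => J (ω i)) n] at hω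
  have : (∑ i ∈ Finset.range n, J (ω i)) / n < c := by
    rw [div_lt_iff₀ hn']; linarith
  rw [Real.dist_eq]
  refine le_trans ?_ (neg_le_abs _)
  linarith

end WeakLaw

/-! ### Error bounds averaged over i.i.d. codebooks. -/

section RandomCoding

variable {W B O : Type*} [MeasurableSpace W] [MeasurableSpace B] [MeasurableSpace O]

/-- The score of the codeword `w` when `o` is received. -/
def score (j : W → O → ℝ) {n : ℕ} (w : Fin n → W) (o : Fin n → O) : ℝ := ∑ i, j (w i) (o i)

lemma measurable_score {j : W → O → ℝ} (hj : Measurable (Function.uncurry j)) (n : ℕ) :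
    Measurable fun p : (Fin n → W) × (Fin n → O) => score j p.1 p.2 := by
  unfold score
  exact Finset.measurable_sum _ fun i _ => hj.comp
    (f := fun p : (Fin n → W) × (Fin n → O) => (p.1 i, p.2 i)) (by fun_prop)

open Classical in
/-- The unique element of a subset of `Fin M` that is a singleton, `m₀` for any other subset. -/
def uniqueOr {M : ℕ} (m₀ : Fin M) (s : Fin M → Prop) : Fin M :=
  if h : ∃ m, s m ∧ ∀ m', s m' → m' = m then h.choose else m₀

lemma uniqueOr_eq {M : ℕ} (m₀ : Fin M) {s : Fin M → Prop} {m : Fin M} (hm : s m)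
    (hu : ∀ m', s m' → m' = m) : uniqueOr m₀ s = m := by
  have h : ∃ m, s m ∧ ∀ m', s m' → m' = m := ⟨m, hm, hu⟩
  rw [uniqueOr, dif_pos h]
  exact hu _ h.choose_spec.1

/-- The decoder that returns the unique message whose score reaches the threshold `θ`. -/
def thresholdDec (j : W → O → ℝ) {n M : ℕ} (θ : ℝ) (m₀ : Fin M) (cb : Fin M → Fin n → W)
    (o : Fin n → O) : Fin M :=
  uniqueOr m₀ fun m => θ ≤ score j (cb m) o

lemma measurable_thresholdDec {j : W → O → ℝ} (hj : Measurable (Function.uncurry j)) {n M : ℕ}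
    (θ : ℝ) (m₀ : Fin M) (cb : Fin M → Fin n → W) : Measurable (thresholdDec j θ m₀ cb) := by
  -- The choice of a message depends only on the finite pattern of threshold tests.
  have h1 : Measurable (uniqueOr m₀) := measurable_of_finite _
  refine h1.comp (measurable_pi_lambda _ fun m => ?_)
  exact measurableSet_setOfPred.1 (measurableSet_le measurable_const
    ((measurable_score hj n).comp measurable_prodMk_left))

/-- The union bound on the probability of error for the message `m`, for the threshold decoder. -/
def errBound (j : W → O → ℝ) (out : W → B → O) (β : Measure B) {n M : ℕ} (θ : ℝ) (m : Fin M)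
    (cb : Fin M → Fin n → W) : ℝ≥0∞ :=
  Measure.pi (fun _ : Fin n => β) {b | score j (cb m) (fun i => out (cb m i) (b i)) < θ} +
    ∑ m' ∈ Finset.univ.erase m,
      Measure.pi (fun _ : Fin n => β) {b | θ ≤ score j (cb m') (fun i => out (cb m i) (b i))}

lemma measure_thresholdDec_ne_le {W B O : Type*} [MeasurableSpace B] (j : W → O → ℝ)
    (out : W → B → O) (β : Measure B) {n M : ℕ}
    (θ : ℝ) (m₀ m : Fin M) (cb : Fin M → Fin n → W) :
    Measure.pi (fun _ : Fin n => β)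
      {b | thresholdDec j θ m₀ cb (fun i => out (cb m i) (b i)) ≠ m} ≤
      errBound j out β θ m cb := by
  refine le_trans (measure_mono ?_) ((measure_union_le _ _).trans
    (add_le_add_right (measure_biUnion_finset_le (Finset.univ.erase m) _) _))
  intro b hb
  by_contra hcon
  simp only [Set.mem_union, Set.mem_ofPred_eq, Set.mem_iUnion, not_or, not_lt, not_exists,
    Finset.mem_erase, Finset.mem_univ, and_true] at hcon
  refine hb (uniqueOr_eq m₀ hcon.1 fun m' hm' => ?_)
  by_contra hne
  exact hcon.2 m' hne hm'

variable {Q : Measure W} [IsProbabilityMeasure Q] {β : Measure B} [IsProbabilityMeasure β]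
  {j : W → O → ℝ} {out : W → B → O}

/-- The law of a codebook whose `M * n` symbols are i.i.d. with law `Q`. -/
def codebookLaw (Q : Measure W) (n M : ℕ) : Measure (Fin M → Fin n → W) :=
  Measure.pi fun _ => Measure.pi fun _ => Q

instance (n M : ℕ) : IsProbabilityMeasure (codebookLaw Q n M) := by
  unfold codebookLaw; infer_instance

lemma lintegral_codebookLaw_eval {n M : ℕ} (m : Fin M) {f : (Fin n → W) → ℝ≥0∞}
    (hf : Measurable f) :
    ∫⁻ cb, f (cb m) ∂codebookLaw Q n M = ∫⁻ w, f w ∂Measure.pi fun _ : Fin n => Q :=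
  (measurePreserving_eval (fun _ : Fin M => Measure.pi fun _ : Fin n => Q) m).lintegral_comp hf

lemma lintegral_codebookLaw_eval_pair {n M : ℕ} {m m' : Fin M} (hm : m ≠ m')
    {f : (Fin n → W) × (Fin n → W) → ℝ≥0∞} (hf : Measurable f) :
    ∫⁻ cb, f (cb m, cb m') ∂codebookLaw Q n M =
      ∫⁻ p, f p ∂(Measure.pi fun _ : Fin n => Q).prod (Measure.pi fun _ : Fin n => Q) := by
  have hind := (iIndepFun_pi (μ := fun _ : Fin M => Measure.pi fun _ : Fin n => Q)
    (X := fun _ w => w) fun _ => aemeasurable_id).indepFun hm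
  have hmap := (indepFun_iff_map_prod_eq_prod_map_map
    (measurable_pi_apply m).aemeasurable (measurable_pi_apply m').aemeasurable).1 hind
  have he : ∀ k : Fin M, Measure.map (fun cb : Fin M → Fin n → W => cb k)
      (Measure.pi fun _ : Fin M => Measure.pi fun _ : Fin n => Q) =
      Measure.pi fun _ : Fin n => Q := fun k =>
    (measurePreserving_eval (fun _ : Fin M => Measure.pi fun _ : Fin n => Q) k).map_eq
  rw [he, he] at hmap
  rw [← hmap, lintegral_map hf (by fun_prop)]
  rfl

lemma measurable_score_output (hj : Measurable (Function.uncurry j))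
    (hout : Measurable (Function.uncurry out)) (n : ℕ) :
    Measurable fun p : ((Fin n → W) × (Fin n → W)) × (Fin n → B) =>
      score j p.1.2 (fun i => out (p.1.1 i) (p.2 i)) := by
  refine (measurable_score hj n).comp (f := fun p : ((Fin n → W) × (Fin n → W)) × (Fin n → B) =>
    (p.1.2, fun i => out (p.1.1 i) (p.2 i))) (Measurable.prodMk (by fun_prop) ?_)
  exact measurable_pi_lambda _ fun i => hout.comp
    (f := fun p : ((Fin n → W) × (Fin n → W)) × (Fin n → B) => (p.1.1 i, p.2 i)) (by fun_prop)

lemma measurable_miss (hj : Measurable (Function.uncurry j))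
    (hout : Measurable (Function.uncurry out)) (n : ℕ) (θ : ℝ) :
    Measurable fun w : Fin n → W => Measure.pi (fun _ : Fin n => β)
      {b | score j w (fun i => out (w i) (b i)) < θ} :=
  measurable_measure_prodMk_left (measurableSet_lt
    ((measurable_score_output hj hout n).comp
      (f := fun p : (Fin n → W) × (Fin n → B) => ((p.1, p.1), p.2)) (by fun_prop))
    measurable_const)

lemma measurable_falseAlarm (hj : Measurable (Function.uncurry j))
    (hout : Measurable (Function.uncurry out)) (n : ℕ) (θ : ℝ) :
    Measurable fun p : (Fin n → W) × (Fin n → W) => Measure.pi (fun _ : Fin n => β)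
      {b | θ ≤ score j p.2 (fun i => out (p.1 i) (b i))} :=
  measurable_measure_prodMk_left
    (measurableSet_le measurable_const (measurable_score_output hj hout n))

lemma measurable_errBound (hj : Measurable (Function.uncurry j))
    (hout : Measurable (Function.uncurry out)) {n M : ℕ} (θ : ℝ) (m : Fin M) :
    Measurable (errBound (n := n) j out β θ m) := by
  refine Measurable.add ((measurable_miss hj hout n θ).comp (measurable_pi_apply m))
    (Finset.measurable_sum _ fun m' _ => ?_)
  exact (measurable_falseAlarm hj hout n θ).comp
    (f := fun cb : Fin M → Fin n → W => (cb m, cb m')) (by fun_prop)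

lemma lintegral_miss (hj : Measurable (Function.uncurry j))
    (hout : Measurable (Function.uncurry out)) (n : ℕ) (θ : ℝ) :
    ∫⁻ w, Measure.pi (fun _ : Fin n => β) {b | score j w (fun i => out (w i) (b i)) < θ}
        ∂Measure.pi (fun _ : Fin n => Q) =
      Measure.pi (fun _ : Fin n => Q.prod β) {x | ∑ i, j (x i).1 (out (x i).1 (x i).2) < θ} := by
  have hs : MeasurableSet {p : (Fin n → W) × (Fin n → B) |
      score j p.1 (fun i => out (p.1 i) (p.2 i)) < θ} :=
    measurableSet_lt ((measurable_score_output hj hout n).comp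
      (f := fun p : (Fin n → W) × (Fin n → B) => ((p.1, p.1), p.2)) (by fun_prop)) measurable_const
  have h1 := Measure.prod_apply (μ := Measure.pi fun _ : Fin n => Q)
    (ν := Measure.pi fun _ : Fin n => β) hs
  have h2 := (measurePreserving_arrowProdEquivProdArrow W B (Fin n)
    (fun _ => Q) (fun _ => β)).measure_preimage hs.nullMeasurableSet
  exact h1.symm.trans h2.symm

/-- Markov's inequality for the exponential of the score, whose mean factors over the independent
letters. The observation is arbitrary, so nothing is asked of its law. -/
lemma measure_le_score_le {O : Type*} {j : W → O → ℝ}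
    (hexp : ∀ o, Integrable (fun w => Real.exp (j w o)) Q)
    (hexp1 : ∀ o, ∫ w, Real.exp (j w o) ∂Q ≤ 1) {n : ℕ} (θ : ℝ) (o : Fin n → O) :
    Measure.pi (fun _ : Fin n => Q) {w | θ ≤ score j w o} ≤ ENNReal.ofReal (Real.exp (-θ)) := by
  have hi : Integrable (fun w : Fin n → W => ∏ i, Real.exp (j (w i) (o i)))
      (Measure.pi fun _ : Fin n => Q) :=
    Integrable.fintype_prod (f := fun i w => Real.exp (j w (o i))) fun i => hexp (o i)
  have h1 := mul_meas_ge_le_integral_of_nonneg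
    (Filter.Eventually.of_forall fun w => Finset.prod_nonneg fun i _ => Real.exp_nonneg _) hi
    (Real.exp θ)
  rw [integral_fintype_prod_eq_prod (fun i w => Real.exp (j w (o i)))] at h1
  have h2 : ∏ i, ∫ w, Real.exp (j w (o i)) ∂Q ≤ 1 :=
    Finset.prod_le_one (fun i _ => integral_nonneg fun w => Real.exp_nonneg _)
      fun i _ => hexp1 (o i)
  have h3 : {w : Fin n → W | θ ≤ score j w o} =
      {w | Real.exp θ ≤ ∏ i, Real.exp (j (w i) (o i))} := by
    ext w
    simp only [Set.mem_ofPred_eq]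
    rw [← Real.exp_sum, Real.exp_le_exp, score]
  rw [h3]
  rw [← ofReal_measureReal]
  refine ENNReal.ofReal_le_ofReal ?_
  rw [Real.exp_neg, ← one_div, le_div_iff₀ (Real.exp_pos θ), mul_comm]
  exact h1.trans h2

/-- A competing codeword is independent of the channel output. Exchanging the integrals freezes the
output, and `measure_le_score_le` applies pointwise. -/
lemma lintegral_falseAlarm_le (hj : Measurable (Function.uncurry j))
    (hout : Measurable (Function.uncurry out))
    (hexp : ∀ o, Integrable (fun w => Real.exp (j w o)) Q)
    (hexp1 : ∀ o, ∫ w, Real.exp (j w o) ∂Q ≤ 1) (n : ℕ) (θ : ℝ) :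
    ∫⁻ p : (Fin n → W) × (Fin n → W), Measure.pi (fun _ : Fin n => β)
        {b | θ ≤ score j p.2 (fun i => out (p.1 i) (b i))}
        ∂(Measure.pi fun _ : Fin n => Q).prod (Measure.pi fun _ : Fin n => Q) ≤
      ENNReal.ofReal (Real.exp (-θ)) := by
  rw [lintegral_prod _ (measurable_falseAlarm hj hout n θ).aemeasurable]
  refine (lintegral_mono (g := fun _ => ENNReal.ofReal (Real.exp (-θ))) fun w => ?_).trans_eq
    (by simp)
  have hs : MeasurableSet {p : (Fin n → W) × (Fin n → B) |
      θ ≤ score j p.1 (fun i => out (w i) (p.2 i))} :=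
    measurableSet_le measurable_const ((measurable_score_output hj hout n).comp
      (f := fun p : (Fin n → W) × (Fin n → B) => ((w, p.1), p.2)) (by fun_prop))
  have h1 := Measure.prod_apply (μ := Measure.pi fun _ : Fin n => Q)
    (ν := Measure.pi fun _ : Fin n => β) hs
  have h2 := Measure.prod_apply_symm (μ := Measure.pi fun _ : Fin n => Q)
    (ν := Measure.pi fun _ : Fin n => β) hs
  refine (h1.symm.trans h2).trans_le ?_
  refine (lintegral_mono (g := fun _ => ENNReal.ofReal (Real.exp (-θ))) fun b => ?_).trans_eq
    (by simp)
  exact measure_le_score_le hexp hexp1 θ fun i => out (w i) (b i)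

lemma lintegral_errBound_le (hj : Measurable (Function.uncurry j))
    (hout : Measurable (Function.uncurry out))
    (hexp : ∀ o, Integrable (fun w => Real.exp (j w o)) Q)
    (hexp1 : ∀ o, ∫ w, Real.exp (j w o) ∂Q ≤ 1) {n M : ℕ} (θ : ℝ) (m : Fin M) :
    ∫⁻ cb, errBound j out β θ m cb ∂codebookLaw Q n M ≤
      Measure.pi (fun _ : Fin n => Q.prod β) {x | ∑ i, j (x i).1 (out (x i).1 (x i).2) < θ} +
        (M - 1 : ℕ) * ENNReal.ofReal (Real.exp (-θ)) := by
  unfold errBound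
  have hm1 := (measurable_miss (β := β) hj hout n θ).comp
    (measurable_pi_apply (X := fun _ : Fin M => Fin n → W) m)
  simp only [Function.comp_def] at hm1
  have hm2 (m' : Fin M) := (measurable_falseAlarm (β := β) hj hout n θ).comp
      (f := fun cb : Fin M → Fin n → W => (cb m, cb m')) (by fun_prop)
  simp only [Function.comp_def] at hm2
  rw [lintegral_add_left hm1, lintegral_finsetSum _ fun m' _ => hm2 m']
  refine add_le_add ?_ ?_
  · rw [lintegral_codebookLaw_eval m (measurable_miss hj hout n θ), lintegral_miss hj hout]
  · refine (Finset.sum_le_card_nsmul _ _ (ENNReal.ofReal (Real.exp (-θ))) fun m' hm' => ?_).trans_eq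
      (by simp [Finset.card_erase_of_mem])
    exact (lintegral_codebookLaw_eval_pair (Finset.ne_of_mem_erase hm').symm
      (measurable_falseAlarm hj hout n θ)).trans_le
      (lintegral_falseAlarm_le hj hout hexp hexp1 n θ)

end RandomCoding

/-! ### The information density of the optimal model -/

/-- The logarithm of `q(y | a, h) / q(y | h)` for the optimal model. -/
def infoDensity (κ : Kernel ℂ 𝒮) (Pol : 𝒮 → ℝ≥0) (a : ℂ) (o : ℂ × ℂ) : ℝ :=
  Real.log (1 + snr κ Pol o.2) +
    ‖o.1‖ ^ 2 / (residualPower κ Pol o.2 + (‖o.2‖ * sqrtMean κ Pol o.2) ^ 2) -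
    ‖o.1 - o.2 * (sqrtMean κ Pol o.2 : ℝ) * a‖ ^ 2 / residualPower κ Pol o.2

/-- The channel output and the receiver side information `(Y, H)` as a function of the adaptive
symbol `√P(·) a` and of the state and noise `((H, S_T), Z)`. -/
def fadingOut (Pol : 𝒮 → ℝ≥0) (a : ℂ) (b : (ℂ × 𝒮) × ℂ) : ℂ × ℂ :=
  (b.1.1 * ((√(Pol b.1.2 : ℝ) : ℝ) * a) + b.2, b.1.1)

lemma measurable_infoDensity (κ : Kernel ℂ 𝒮) [IsSFiniteKernel κ] {Pol : 𝒮 → ℝ≥0}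
    (hPol : Measurable Pol) : Measurable (Function.uncurry (infoDensity κ Pol)) := by
  have h1 := measurable_sqrtMean κ hPol
  have h2 := measurable_residualPower κ hPol
  have h3 := measurable_snr κ hPol
  unfold infoDensity
  simp only [Function.uncurry_def]
  fun_prop

lemma measurable_fadingOut {Pol : 𝒮 → ℝ≥0} (hPol : Measurable Pol) :
    Measurable (Function.uncurry (fadingOut Pol)) := by
  unfold fadingOut
  simp only [Function.uncurry_def]
  fun_prop

lemma exp_infoDensity (κ : Kernel ℂ 𝒮) (Pol : 𝒮 → ℝ≥0) (a : ℂ) (o : ℂ × ℂ) :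
    Real.exp (infoDensity κ Pol a o) =
      (1 + snr κ Pol o.2) * Real.exp (‖o.1‖ ^ 2 /
        (residualPower κ Pol o.2 + (‖o.2‖ * sqrtMean κ Pol o.2) ^ 2)) *
        Real.exp (-(‖o.1 - o.2 * (sqrtMean κ Pol o.2 : ℝ) * a‖ ^ 2 / residualPower κ Pol o.2)) := by
  rw [infoDensity, sub_eq_add_neg, Real.exp_add, Real.exp_add,
    Real.exp_log (by linarith [snr_nonneg κ Pol o.2])]

lemma integrable_exp_infoDensity (κ : Kernel ℂ 𝒮) (Pol : 𝒮 → ℝ≥0) (o : ℂ × ℂ) :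
    Integrable (fun a => Real.exp (infoDensity κ Pol a o)) (cscg 1) := by
  simp_rw [exp_infoDensity]
  refine Integrable.const_mul (Integrable.of_bound (C := 1) ?_
    (Filter.Eventually.of_forall fun a => ?_)) _
  · exact (by fun_prop : Measurable _).aestronglyMeasurable
  · have := residualPower_pos κ Pol o.2
    rw [Real.norm_of_nonneg (Real.exp_nonneg _), Real.exp_le_one_iff, neg_nonpos]
    positivity

/-- The density is the logarithm of a likelihood over its own average, so the ratio averages to one
for every observation. This is the normalisation behind the false-alarm bound. -/
lemma integral_exp_infoDensity (κ : Kernel ℂ 𝒮) {Pol : 𝒮 → ℝ≥0} (hPol : Measurable Pol)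
    (o : ℂ × ℂ) : ∫ a, Real.exp (infoDensity κ Pol a o) ∂cscg 1 = 1 := by
  have hN := residualPower_pos κ Pol o.2
  have h := (optimalModel κ hPol).integral_exp_neg_signal o.2 hN o.1
  rw [optimalModel_signal, optimalModel_signalPower] at h
  change ∫ a, _ ∂cscg 1 = _ at h
  simp_rw [exp_infoDensity]
  rw [integral_const_mul, h, snr_eq_div_residualPower, Real.exp_neg]
  have : 0 < residualPower κ Pol o.2 + (‖o.2‖ * sqrtMean κ Pol o.2) ^ 2 := by positivity
  have he := Real.exp_ne_zero
    (‖o.1‖ ^ 2 / (residualPower κ Pol o.2 + (‖o.2‖ * sqrtMean κ Pol o.2) ^ 2))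
  generalize Real.exp (‖o.1‖ ^ 2 /
    (residualPower κ Pol o.2 + (‖o.2‖ * sqrtMean κ Pol o.2) ^ 2)) = E at *
  field_simp

section Mean

variable {PH : Measure ℂ} [IsProbabilityMeasure PH] {κ : Kernel ℂ 𝒮} [IsMarkovKernel κ]
  {Pol : 𝒮 → ℝ≥0}

lemma lintegral_symbol_state_noise {f : ℂ × (ℂ × 𝒮) × ℂ → ℝ≥0∞} (hf : Measurable f) :
    ∫⁻ p, f p ∂(cscg 1).prod ((PH ⊗ₘ κ).prod (cscg 1)) =
      ∫⁻ h, ∫⁻ p : ℂ × 𝒮 × ℂ, f (p.1, (h, p.2.1), p.2.2)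
        ∂(cscg 1).prod ((κ h).prod (cscg 1)) ∂PH := by
  have h1 : Measurable fun q : (ℂ × 𝒮) × ℂ => ∫⁻ a, f (a, q) ∂cscg 1 := hf.lintegral_prod_left'
  have h2 : Measurable fun q : ℂ × 𝒮 => ∫⁻ z, ∫⁻ a, f (a, q, z) ∂cscg 1 ∂cscg 1 :=
    h1.lintegral_prod_right'
  rw [lintegral_prod_symm _ hf.aemeasurable, lintegral_prod _ h1.aemeasurable,
    Measure.lintegral_compProd h2]
  refine lintegral_congr fun h => ?_
  have h3 : Measurable fun p : ℂ × 𝒮 × ℂ => f (p.1, (h, p.2.1), p.2.2) := by fun_prop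
  rw [lintegral_prod_symm _ h3.aemeasurable, lintegral_prod _ h3.lintegral_prod_left'.aemeasurable]

/-- Since `f` is nonnegative, Tonelli turns conditional means equal to one into both integrability
and the total mean. -/
lemma integrable_and_integral_eq_one {f : ℂ × (ℂ × 𝒮) × ℂ → ℝ} (hf : Measurable f)
    (hf0 : ∀ p, 0 ≤ f p) (hi : ∀ᵐ h ∂PH, Integrable
      (fun p : ℂ × 𝒮 × ℂ => f (p.1, (h, p.2.1), p.2.2)) ((cscg 1).prod ((κ h).prod (cscg 1))))
    (h1 : ∀ᵐ h ∂PH, ∫ p : ℂ × 𝒮 × ℂ, f (p.1, (h, p.2.1), p.2.2)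
      ∂(cscg 1).prod ((κ h).prod (cscg 1)) = 1) :
    Integrable f ((cscg 1).prod ((PH ⊗ₘ κ).prod (cscg 1))) ∧
      ∫ p, f p ∂(cscg 1).prod ((PH ⊗ₘ κ).prod (cscg 1)) = 1 := by
  have hl : ∫⁻ p, ENNReal.ofReal (f p) ∂(cscg 1).prod ((PH ⊗ₘ κ).prod (cscg 1)) = 1 := by
    rw [lintegral_symbol_state_noise hf.ennreal_ofReal, lintegral_congr_ae (g := fun _ => 1)]
    · simp
    · filter_upwards [hi, h1] with h hh hh1
      rw [← ofReal_integral_eq_lintegral_ofReal hh (Filter.Eventually.of_forall fun p => hf0 _),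
        hh1, ENNReal.ofReal_one]
  constructor
  · refine ⟨hf.aestronglyMeasurable, ?_⟩
    rw [hasFiniteIntegral_iff_ofReal (Filter.Eventually.of_forall hf0), hl]
    exact ENNReal.one_lt_top
  · rw [integral_eq_lintegral_of_nonneg_ae (Filter.Eventually.of_forall hf0)
      hf.aestronglyMeasurable, hl, ENNReal.toReal_one]

lemma integral_norm_sq_sub_signal_optimalModel (hPol : Measurable Pol) {h : ℂ}
    (hint : Integrable (fun s => (Pol s : ℝ)) (κ h)) :
    ∫ p : ℂ × 𝒮 × ℂ, ‖h * ((√(Pol p.2.1 : ℝ) : ℝ) * p.1) + p.2.2 -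
        h * (sqrtMean κ Pol h : ℝ) * p.1‖ ^ 2 ∂(cscg 1).prod ((κ h).prod (cscg 1)) =
      residualPower κ Pol h := by
  let F := optimalModel κ hPol
  have hY := F.memLp_output hPol hint h
  have hU := F.memLp_signal_law (ρ := κ h) h
  have iY := hY.integrable_norm_pow (by simp)
  have iU := hU.integrable_norm_pow (by simp)
  have iYU := (integrable_inner_of_memLp_two hY hU).const_mul 2
  have e1 := F.integral_norm_sq_output hPol hint h
  have e2 := F.integral_inner_output_signal hPol hint h
  have e3 := F.integral_norm_sq_signal_law (ρ := κ h) h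
  rw [optimalModel_correlation] at e2
  rw [optimalModel_signalPower] at e3
  have key : ∫ p, ‖h * F.X p.2.1 p.1 + p.2.2 - F.signal h p.1‖ ^ 2 ∂F.law (κ h) =
      residualPower κ Pol h := by
    simp_rw [norm_sub_sq_real]
    have iS : Integrable (fun p : F.A × 𝒮 × ℂ => ‖h * F.X p.2.1 p.1 + p.2.2‖ ^ 2 -
      2 * inner ℝ (h * F.X p.2.1 p.1 + p.2.2) (F.signal h p.1)) (F.law (κ h)) := iY.sub iYU
    rw [integral_add iS iU, integral_sub iY iYU, integral_const_mul, e1, e2, e3,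
      residualPower_eq hPol hint]
    ring
  have hs : F.signal h = fun a : ℂ => h * (sqrtMean κ Pol h : ℝ) * a := optimalModel_signal κ hPol h
  rw [hs] at key
  exact key

/-- Each of the two quadratic terms is divided by its conditional mean given the fading, so each has
mean one and they cancel. Only the logarithmic term contributes. Normalising for each `h` gives
integrability without moments beyond those assumed. -/
lemma integrable_infoDensity (hPol : Measurable Pol)
    (hH2 : Integrable (fun h : ℂ => ‖h‖ ^ 2) PH)
    (hint : Integrable (fun p : ℂ × 𝒮 => (Pol p.2 : ℝ)) (PH ⊗ₘ κ)) :
    Integrable (fun p : ℂ × (ℂ × 𝒮) × ℂ => infoDensity κ Pol p.1 (fadingOut Pol p.1 p.2))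
        ((cscg 1).prod ((PH ⊗ₘ κ).prod (cscg 1))) ∧
      ∫ p, infoDensity κ Pol p.1 (fadingOut Pol p.1 p.2)
          ∂(cscg 1).prod ((PH ⊗ₘ κ).prod (cscg 1)) =
        ∫ h, Real.log (1 + snr κ Pol h) ∂PH := by
  have m1 := measurable_sqrtMean κ hPol
  have m2 := measurable_residualPower κ hPol
  have hlog := integrable_log_one_add_snr hPol hH2 hint
  have hae := ae_integrable_pol hint
  have hpos : ∀ h : ℂ, 0 < residualPower κ Pol h + (‖h‖ * sqrtMean κ Pol h) ^ 2 := fun h => by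
    have := residualPower_pos κ Pol h
    positivity
  obtain ⟨iA, eA⟩ := integrable_and_integral_eq_one (PH := PH) (κ := κ)
    (f := fun p => ‖(fadingOut Pol p.1 p.2).1‖ ^ 2 /
      (residualPower κ Pol p.2.1.1 + (‖p.2.1.1‖ * sqrtMean κ Pol p.2.1.1) ^ 2))
    (by unfold fadingOut; fun_prop)
    (fun p => div_nonneg (sq_nonneg _) (hpos _).le)
    (by
      filter_upwards [hae] with h hh
      exact (((optimalModel κ hPol).memLp_output hPol hh h).integrable_norm_pow
        (by simp)).div_const _)
    (by
      filter_upwards [hae] with h hh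
      have h1 := (optimalModel κ hPol).integral_norm_sq_output hPol hh h
      have h2 := residualPower_eq hPol hh
      have h3 := (hpos h).ne'
      simp only [fadingOut]
      rw [integral_div]
      refine (div_eq_one_iff_eq h3).2 (Eq.trans h1 ?_)
      linarith)
  obtain ⟨iB, eB⟩ := integrable_and_integral_eq_one (PH := PH) (κ := κ)
    (f := fun p => ‖(fadingOut Pol p.1 p.2).1 - p.2.1.1 * (sqrtMean κ Pol p.2.1.1 : ℝ) * p.1‖ ^ 2 /
      residualPower κ Pol p.2.1.1)
    (by unfold fadingOut; fun_prop)
    (fun p => div_nonneg (sq_nonneg _) (residualPower_pos _ _ _).le)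
    (by
      filter_upwards [hae] with h hh
      have h1 := (((optimalModel κ hPol).memLp_output hPol hh h).sub
        ((optimalModel κ hPol).memLp_signal_law h)).integrable_norm_pow (by simp)
      rw [optimalModel_signal] at h1
      exact h1.div_const _)
    (by
      filter_upwards [hae] with h hh
      simp only [fadingOut]
      rw [integral_div, integral_norm_sq_sub_signal_optimalModel hPol hh,
        div_self (residualPower_pos _ _ _).ne'])
  have hfst : MeasurePreserving (fun p : ℂ × (ℂ × 𝒮) × ℂ => p.2.1.1)
      ((cscg 1).prod ((PH ⊗ₘ κ).prod (cscg 1))) PH :=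
    (⟨measurable_fst, by rw [← Measure.fst, Measure.fst_compProd]⟩ :
      MeasurePreserving Prod.fst (PH ⊗ₘ κ) PH).comp
      (measurePreserving_fst.comp measurePreserving_snd)
  have iL := hfst.integrable_comp_of_integrable hlog
  have eL : ∫ p : ℂ × (ℂ × 𝒮) × ℂ, Real.log (1 + snr κ Pol p.2.1.1)
      ∂(cscg 1).prod ((PH ⊗ₘ κ).prod (cscg 1)) = ∫ h, Real.log (1 + snr κ Pol h) ∂PH := by
    conv_rhs => rw [← hfst.map_eq]
    rw [integral_map hfst.measurable.aemeasurable (by rw [hfst.map_eq]; exact hlog.1)]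
  have iLA := iL.add iA
  refine ⟨iLA.sub iB, ?_⟩
  have := integral_sub iLA iB
  simp only [Pi.add_apply, Function.comp_apply] at this
  refine this.trans ?_
  have h4 := integral_add iL iA
  simp only [Function.comp_apply] at h4
  rw [h4, eA, eB, eL]
  ring

end Mean

/-! ### Codes from codebooks -/

/-- The code that sends `√P(S_{T,i}) w_{m,i}` and decodes with a threshold on the information
density. -/
def codebookCode (κ : Kernel ℂ 𝒮) [IsSFiniteKernel κ] {Pol : 𝒮 → ℝ≥0} (hPol : Measurable Pol)
    {n M : ℕ} (θ : ℝ) (m₀ : Fin M) (cb : Fin M → Fin n → ℂ) : Code 𝒮 n M where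
  enc i m st := (√(Pol (st ⟨i, le_rfl⟩) : ℝ) : ℝ) * cb m i
  measurable_enc i m := by fun_prop
  dec := thresholdDec (infoDensity κ Pol) θ m₀ cb
  measurable_dec := measurable_thresholdDec (measurable_infoDensity κ hPol) θ m₀ cb

lemma ofReal_errorProb_codebookCode_le (κ : Kernel ℂ 𝒮) [IsSFiniteKernel κ] {Pol : 𝒮 → ℝ≥0}
    (hPol : Measurable Pol) {n M : ℕ} (θ : ℝ) (m₀ : Fin M) (cb : Fin M → Fin n → ℂ)
    (ν : Measure (ℂ × 𝒮)) [IsProbabilityMeasure ν] :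
    ENNReal.ofReal ((codebookCode κ hPol θ m₀ cb).errorProb ν) ≤
      (∑ m, errBound (infoDensity κ Pol) (fadingOut Pol) (ν.prod (cscg 1)) θ m cb) / M := by
  have hM : (0 : ℝ) < M := by
    have : 0 < M := m₀.pos
    exact_mod_cast this
  rw [Code.errorProb, ENNReal.ofReal_div_of_pos hM, ENNReal.ofReal_natCast,
    ENNReal.ofReal_sum_of_nonneg fun _ _ => measureReal_nonneg]
  gcongr with m
  rw [ofReal_measureReal]
  have h := (measurePreserving_arrowProdEquivProdArrow (ℂ × 𝒮) ℂ (Fin n)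
    (fun _ => ν) (fun _ => cscg 1)).measure_preimage_equiv
    {p | (codebookCode κ hPol θ m₀ cb).dec
      ((codebookCode κ hPol θ m₀ cb).received m p.1 p.2) ≠ m}
  rw [← h]
  exact measure_thresholdDec_ne_le (infoDensity κ Pol) (fadingOut Pol) (ν.prod (cscg 1)) θ m₀ m cb

lemma avgPower_codebookCode (κ : Kernel ℂ 𝒮) [IsSFiniteKernel κ] {Pol : 𝒮 → ℝ≥0}
    (hPol : Measurable Pol) {n M : ℕ} (θ : ℝ) (m₀ : Fin M) (cb : Fin M → Fin n → ℂ)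
    (ν : Measure (ℂ × 𝒮)) [IsProbabilityMeasure ν] :
    (codebookCode κ hPol θ m₀ cb).avgPower ν =
      (∑ m, ∑ i, ‖cb m i‖ₑ ^ 2) / (M * n) * ∫⁻ p, Pol p.2 ∂ν := by
  have key : ∀ m i, ∫⁻ σ, ‖(codebookCode κ hPol θ m₀ cb).input m σ i‖ₑ ^ 2
      ∂(Measure.pi fun _ : Fin n => ν) = ‖cb m i‖ₑ ^ 2 * ∫⁻ p, Pol p.2 ∂ν := by
    intro m i
    rw [← lintegral_const_mul _ (by fun_prop), ← (measurePreserving_eval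
      (fun _ : Fin n => ν) i).lintegral_comp (by fun_prop)]
    refine lintegral_congr fun σ => ?_
    simp only [Code.input, codebookCode, Function.eval, enorm_mul, mul_pow]
    rw [mul_comm]
    congr 1
    rw [← ofReal_norm, Complex.norm_real, Real.norm_of_nonneg (Real.sqrt_nonneg _),
      ← ENNReal.ofReal_pow (Real.sqrt_nonneg _), Real.sq_sqrt (NNReal.coe_nonneg _),
      ENNReal.ofReal_coe_nnreal]
  rw [Code.avgPower]
  simp_rw [key, ← Finset.sum_mul]
  rw [ENNReal.div_eq_inv_mul, ENNReal.div_eq_inv_mul, mul_assoc]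

lemma lintegral_sum_enorm_sq_codebookLaw (n M : ℕ) :
    ∫⁻ cb, ∑ m : Fin M, ∑ i : Fin n, ‖cb m i‖ₑ ^ 2 ∂codebookLaw (cscg 1) n M = M * n := by
  have key : ∀ (m : Fin M) (i : Fin n),
      ∫⁻ cb, ‖cb m i‖ₑ ^ 2 ∂codebookLaw (cscg 1) n M = 1 := by
    intro m i
    rw [lintegral_codebookLaw_eval m (f := fun w => ‖w i‖ₑ ^ 2) (by fun_prop)]
    exact ((measurePreserving_eval (fun _ : Fin n => cscg 1) i).lintegral_comp
      (f := fun z => ‖z‖ₑ ^ 2) (by fun_prop)).trans (by simp [lintegral_enorm_sq_cscg])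
  rw [lintegral_finsetSum _ fun m _ => by fun_prop]
  simp_rw [fun m : Fin M => lintegral_finsetSum (μ := codebookLaw (cscg 1) n M) Finset.univ
    (f := fun (i : Fin n) (cb : Fin M → Fin n → ℂ) => ‖cb m i‖ₑ ^ 2) fun i _ => by fun_prop]
  simp [key]

/-! ### Vanishing error, power slack and selection of a codebook. -/

section Achievability

variable {PH : Measure ℂ} [IsProbabilityMeasure PH] {κ : Kernel ℂ 𝒮} [IsMarkovKernel κ]
  {Pol : 𝒮 → ℝ≥0}

/-- The error bound averaged over random Gaussian codebooks with `⌈exp (n r)⌉` messages vanishes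
at every rate `r` below `E[log (1 + SNR(H))]`. -/
lemma exists_lintegral_errBound_le (hPol : Measurable Pol)
    (hH2 : Integrable (fun h : ℂ => ‖h‖ ^ 2) PH)
    (hint : Integrable (fun p : ℂ × 𝒮 => (Pol p.2 : ℝ)) (PH ⊗ₘ κ)) {r : ℝ}
    (hr : r < ∫ h, Real.log (1 + snr κ Pol h) ∂PH) {η : ℝ≥0∞} (hη : 0 < η) :
    ∃ N : ℕ, ∀ n : ℕ, N ≤ n → ∃ θ : ℝ,
      ∫⁻ cb, (∑ m, errBound (infoDensity κ Pol) (fadingOut Pol) ((PH ⊗ₘ κ).prod (cscg 1)) θ m cb) /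
        (⌈Real.exp (n * r)⌉₊ : ℝ≥0∞) ∂codebookLaw (cscg 1) n ⌈Real.exp (n * r)⌉₊ ≤ η := by
  obtain ⟨c, hrc, hc⟩ := exists_between hr
  have hj := measurable_infoDensity κ hPol
  have hout := measurable_fadingOut hPol
  obtain ⟨hJ, hmean⟩ := integrable_infoDensity hPol hH2 hint
  rw [← hmean] at hc
  have hJm : Measurable fun p : ℂ × (ℂ × 𝒮) × ℂ =>
      infoDensity κ Pol p.1 (fadingOut Pol p.1 p.2) :=
    hj.comp (f := fun p : ℂ × (ℂ × 𝒮) × ℂ => (p.1, fadingOut Pol p.1 p.2))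
      (measurable_fst.prodMk hout)
  have hlim1 := tendsto_measure_pi_sum_lt hJm hJ hc
  have hlim2 : Filter.Tendsto (fun n : ℕ => ENNReal.ofReal (Real.exp (-(n * (c - r)))))
      Filter.atTop (nhds 0) := by
    rw [← ENNReal.ofReal_zero]
    refine ENNReal.tendsto_ofReal (Real.tendsto_exp_neg_atTop_nhds_zero.comp ?_)
    exact tendsto_natCast_atTop_atTop.atTop_mul_const (sub_pos.2 hrc)
  have hlim := hlim1.add hlim2
  rw [add_zero] at hlim
  obtain ⟨N, hN⟩ := Filter.eventually_atTop.1 (hlim.eventually_le_const hη)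
  -- With `r < c < R`, the threshold `n c` lies below the typical score of the sent codeword, while
  -- about `exp (n r)` competitors contribute at most `exp (-n (c - r))`.
  refine ⟨N, fun n hn => ⟨n * c, le_trans ?_ (hN n hn)⟩⟩
  set M := ⌈Real.exp (n * r)⌉₊ with hMdef
  have hM : 0 < M := Nat.ceil_pos.2 (Real.exp_pos _)
  have hM0 : (M : ℝ≥0∞) ≠ 0 := by exact_mod_cast hM.ne'
  -- There are `M - 1` competitors, which absorbs the rounding up in `M`.
  have hM1 : ((M - 1 : ℕ) : ℝ≥0∞) ≤ ENNReal.ofReal (Real.exp (n * r)) := by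
    rw [← ENNReal.ofReal_natCast]
    refine ENNReal.ofReal_le_ofReal ?_
    have := Nat.ceil_lt_add_one (Real.exp_pos (n * r)).le
    rw [Nat.cast_pred hM]
    linarith
  have hmeas : ∀ m : Fin M, Measurable (errBound (n := n) (infoDensity κ Pol) (fadingOut Pol)
      ((PH ⊗ₘ κ).prod (cscg 1)) (n * c) m) := fun m => measurable_errBound hj hout _ m
  simp_rw [ENNReal.div_eq_inv_mul]
  rw [lintegral_const_mul _ (Finset.measurable_sum _ fun m _ => hmeas m),
    lintegral_finsetSum _ fun m _ => hmeas m, ← ENNReal.div_eq_inv_mul]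
  refine ENNReal.div_le_of_le_mul ?_
  refine (Finset.sum_le_card_nsmul _ _ _ fun m _ => (lintegral_errBound_le hj hout
    (fun o => integrable_exp_infoDensity κ Pol o)
    (fun o => (integral_exp_infoDensity κ hPol o).le) (n * c) m).trans (add_le_add_right
      (mul_le_mul_left hM1 _) _)).trans_eq ?_
  rw [← ENNReal.ofReal_mul (Real.exp_nonneg _), ← Real.exp_add, Finset.card_univ, Fintype.card_fin,
    nsmul_eq_mul, mul_comm]
  congr 5
  ring

/-- The numerator scales exactly by `c`, while the variance in the denominator can only shrink. -/
lemma snr_const_mul_ge (κ : Kernel ℂ 𝒮) (Pol : 𝒮 → ℝ≥0) {c : ℝ≥0} (hc : c ≤ 1) (h : ℂ) :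
    c * snr κ Pol h ≤ snr κ (fun s => c * Pol s) h := by
  have hs : ∀ s, √((c * Pol s : ℝ≥0) : ℝ) = √(c : ℝ) * √(Pol s : ℝ) := fun s => by
    rw [NNReal.coe_mul, Real.sqrt_mul (NNReal.coe_nonneg c)]
  have hsq : √(c : ℝ) ^ 2 = c := Real.sq_sqrt (NNReal.coe_nonneg c)
  have hV := variance_nonneg (fun s => √(Pol s : ℝ)) (κ h)
  simp only [snr, hs]
  rw [integral_const_mul, variance_const_mul, mul_pow, hsq, ← mul_div_assoc]
  have e : (c : ℝ) * (‖h‖ ^ 2 * (∫ s, √(Pol s : ℝ) ∂κ h) ^ 2) =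
    ‖h‖ ^ 2 * (c * (∫ s, √(Pol s : ℝ) ∂κ h) ^ 2) := by ring
  rw [e]
  have hc' : (c : ℝ) ≤ 1 := by exact_mod_cast hc
  gcongr
  exact mul_le_of_le_one_left hV hc'

/-- Concavity of the logarithm between `1` and `1 + x`. -/
lemma mul_log_one_add_le {c x : ℝ} (hc0 : 0 ≤ c) (hc1 : c ≤ 1) (hx : 0 ≤ x) :
    c * Real.log (1 + x) ≤ Real.log (1 + c * x) := by
  have h := strictConcaveOn_log_Ioi.concaveOn.2 (x := 1 + x) (y := 1)
    (Set.mem_Ioi.2 (by positivity)) (Set.mem_Ioi.2 one_pos) hc0 (sub_nonneg.2 hc1) (by ring)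
  simp only [smul_eq_mul, Real.log_one, mul_zero, add_zero, mul_one] at h
  refine h.trans_eq ?_
  congr 1
  ring

lemma mul_integral_log_le (hPol : Measurable Pol)
    (hH2 : Integrable (fun h : ℂ => ‖h‖ ^ 2) PH)
    (hint : Integrable (fun p : ℂ × 𝒮 => (Pol p.2 : ℝ)) (PH ⊗ₘ κ)) {c : ℝ≥0} (hc : c ≤ 1) :
    c * ∫ h, Real.log (1 + snr κ Pol h) ∂PH ≤
      ∫ h, Real.log (1 + snr κ (fun s => c * Pol s) h) ∂PH := by
  rw [← integral_const_mul]
  refine integral_mono ((integrable_log_one_add_snr hPol hH2 hint).const_mul _)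
    (integrable_log_one_add_snr (hPol.const_mul c) hH2
      (by simpa only [NNReal.coe_mul] using hint.const_mul (c : ℝ))) fun h => ?_
  have h0 := snr_nonneg κ Pol h
  refine (mul_log_one_add_le (NNReal.coe_nonneg c) (by exact_mod_cast hc) h0).trans ?_
  have : 0 ≤ (c : ℝ) * snr κ Pol h := mul_nonneg (NNReal.coe_nonneg c) h0
  exact Real.log_le_log (by linarith) (by linarith [snr_const_mul_ge κ Pol hc h])

/-- Random codebooks meet the power constraint only on average, and selecting one for small error
could violate it. The shrunken policy `(1 - δ) P` gives the room to meet both requirements at once.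
-/
lemma isAchievableRate_integral_log (hPol : Measurable Pol)
    (hH2 : Integrable (fun h : ℂ => ‖h‖ ^ 2) PH)
    (hint : Integrable (fun p : ℂ × 𝒮 => (Pol p.2 : ℝ)) (PH ⊗ₘ κ)) {Pmax : ℝ≥0}
    (hpower : ∫⁻ p, (Pol p.2 : ℝ≥0∞) ∂(PH ⊗ₘ κ) ≤ Pmax) :
    IsAchievableRate (PH ⊗ₘ κ) Pmax (∫ h, Real.log (1 + snr κ Pol h) ∂PH) := by
  intro ε hε
  set R := ∫ h, Real.log (1 + snr κ Pol h) ∂PH with hR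
  have hR0 : 0 ≤ R := integral_nonneg fun h =>
    Real.log_nonneg (by linarith [snr_nonneg κ Pol h])
  obtain ⟨δ, hδ0, hδ1, hδR⟩ : ∃ δ : ℝ≥0, 0 < δ ∧ δ < 1 ∧ δ * R < ε := by
    have h0 : 0 < ε / (R + 1 + ε) := by positivity
    refine ⟨(ε / (R + 1 + ε)).toNNReal, Real.toNNReal_pos.2 h0, ?_, ?_⟩
    · rw [Real.toNNReal_lt_one, div_lt_one (by positivity)]
      linarith
    · rw [Real.coe_toNNReal _ h0.le, div_mul_eq_mul_div, div_lt_iff₀ (by positivity)]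
      nlinarith
  have hc1 : 1 - δ ≤ 1 := tsub_le_self
  have hcoe : ((1 - δ : ℝ≥0) : ℝ) = 1 - δ := by rw [NNReal.coe_sub hδ1.le, NNReal.coe_one]
  have hr : R - ε < ∫ h, Real.log (1 + snr κ (fun s => (1 - δ) * Pol s) h) ∂PH := by
    refine lt_of_lt_of_le ?_ (mul_integral_log_le hPol hH2 hint hc1)
    rw [hcoe, ← hR]
    linarith
  have hPol' : Measurable fun s => (1 - δ) * Pol s := hPol.const_mul _
  have hε' : 0 < ENNReal.ofReal ε := ENNReal.ofReal_pos.2 hε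
  obtain ⟨N, hN⟩ := exists_lintegral_errBound_le (κ := κ) hPol' hH2
    (by simpa only [NNReal.coe_mul] using hint.const_mul ((1 - δ : ℝ≥0) : ℝ)) hr
    (η := δ * ENNReal.ofReal ε) (ENNReal.mul_pos (by simpa using hδ0.ne') hε'.ne')
  -- Positive length is needed for the normalised codebook power `T` to have mean one.
  refine ⟨max N 1, fun n hn => ?_⟩
  obtain ⟨θ, hθ⟩ := hN n (le_of_max_le_left hn)
  have hn0 : n ≠ 0 := by have := le_of_max_le_right hn; omega
  set M := ⌈Real.exp (n * (R - ε))⌉₊ with hMdef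
  have hM : 0 < M := Nat.ceil_pos.2 (Real.exp_pos _)
  set E : (Fin M → Fin n → ℂ) → ℝ≥0∞ := fun cb =>
    (∑ m, errBound (infoDensity κ fun s => (1 - δ) * Pol s) (fadingOut fun s => (1 - δ) * Pol s)
      ((PH ⊗ₘ κ).prod (cscg 1)) θ m cb) / (M : ℝ≥0∞)
  set T : (Fin M → Fin n → ℂ) → ℝ≥0∞ := fun cb => (∑ m, ∑ i, ‖cb m i‖ₑ ^ 2) / (M * n)
  have hEm : Measurable E := (Finset.measurable_sum _ fun m _ => measurable_errBound
    (measurable_infoDensity κ hPol') (measurable_fadingOut hPol') θ m).div_const _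
  have hTm : Measurable T := by fun_prop
  have hT : ∫⁻ cb, T cb ∂codebookLaw (cscg 1) n M = 1 := by
    have h0 : (M * n : ℝ≥0∞) ≠ 0 := by simp [hM.ne', hn0]
    have h1 : (M * n : ℝ≥0∞) ≠ ⊤ := ENNReal.mul_ne_top (by simp) (by simp)
    simp only [T, ENNReal.div_eq_inv_mul]
    rw [lintegral_const_mul _ (by fun_prop), lintegral_sum_enorm_sq_codebookLaw,
      ENNReal.inv_mul_cancel h0 h1]
  -- The power term has mean `1 - δ` and the error term mean at most `δ`. A codebook whose sum is at
  -- most the mean has each summand at most one, which gives the power and error bounds together.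
  have hle : ∫⁻ cb, ((1 - δ : ℝ≥0) * T cb + (ENNReal.ofReal ε)⁻¹ * E cb)
      ∂codebookLaw (cscg 1) n M ≤ 1 := by
    rw [lintegral_add_left (by fun_prop), lintegral_const_mul _ hTm, lintegral_const_mul _ hEm, hT]
    calc ((1 - δ : ℝ≥0) : ℝ≥0∞) * 1 + (ENNReal.ofReal ε)⁻¹ * ∫⁻ cb, E cb ∂codebookLaw (cscg 1) n M
        ≤ ((1 - δ : ℝ≥0) : ℝ≥0∞) * 1 + (ENNReal.ofReal ε)⁻¹ * (δ * ENNReal.ofReal ε) := by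
          gcongr
      _ = ((1 - δ : ℝ≥0) : ℝ≥0∞) + δ := by
          rw [mul_one, mul_left_comm, ENNReal.inv_mul_cancel hε'.ne' ENNReal.ofReal_ne_top, mul_one]
      _ = 1 := by
          rw [← ENNReal.coe_add, tsub_add_cancel_of_le hδ1.le, ENNReal.coe_one]
  obtain ⟨cb, hcb⟩ := exists_le_lintegral (μ := codebookLaw (cscg 1) n M)
    (f := fun cb => (1 - δ : ℝ≥0) * T cb + (ENNReal.ofReal ε)⁻¹ * E cb) (by fun_prop)
  have hcb1 := hcb.trans hle
  refine ⟨M, codebookCode κ hPol' θ ⟨0, hM⟩ cb, Nat.le_ceil _, ?_, ?_⟩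
  · have h1 : (ENNReal.ofReal ε)⁻¹ * E cb ≤ 1 := le_add_self.trans hcb1
    rw [← ENNReal.div_eq_inv_mul, ENNReal.div_le_iff hε'.ne' ENNReal.ofReal_ne_top, one_mul] at h1
    exact (ENNReal.ofReal_le_ofReal_iff hε.le).1
      ((ofReal_errorProb_codebookCode_le κ hPol' θ ⟨0, hM⟩ cb (PH ⊗ₘ κ)).trans h1)
  · rw [avgPower_codebookCode]
    have h1 : ((1 - δ : ℝ≥0) : ℝ≥0∞) * T cb ≤ 1 := le_self_add.trans hcb1
    calc T cb * ∫⁻ p, (((1 - δ) * Pol p.2 : ℝ≥0) : ℝ≥0∞) ∂(PH ⊗ₘ κ)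
        = ((1 - δ : ℝ≥0) : ℝ≥0∞) * T cb * ∫⁻ p, (Pol p.2 : ℝ≥0∞) ∂(PH ⊗ₘ κ) := by
          simp_rw [ENNReal.coe_mul]
          rw [lintegral_const_mul _ (by fun_prop)]
          ring
      _ ≤ 1 * Pmax := mul_le_mul' h1 hpower
      _ = Pmax := one_mul _

end Achievability

end FadingCSIT

end

theorem mainTheorem11 {Ω 𝒮 : Type*} [MeasurableSpace Ω] (μ : Measure Ω) [IsProbabilityMeasure μ]
    [MeasurableSpace 𝒮] [StandardBorelSpace 𝒮] [Nonempty 𝒮]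
    (H : Ω → ℂ) (hH : Measurable H) (hH2 : ∫ ω, ‖H ω‖ ^ 2 ∂μ = 1)
    (ST : Ω → 𝒮) (hST : Measurable ST)
    (Pol : 𝒮 → ℝ≥0) (hPol : Measurable Pol)
    (Pmax : ℝ≥0) (hpower : ∫⁻ ω, (Pol (ST ω) : ℝ≥0∞) ∂μ ≤ Pmax) :
    Integrable (fun ω => Real.log (1 + FadingCSIT.snr (condDistrib ST H μ) Pol (H ω))) μ ∧
    IsGreatest (FadingCSIT.forwardGMIs (μ.map H) (condDistrib ST H μ) Pol)
      (∫ ω, Real.log (1 + FadingCSIT.snr (condDistrib ST H μ) Pol (H ω)) ∂μ) ∧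
    FadingCSIT.IsAchievableRate (μ.map fun ω => (H ω, ST ω)) Pmax
      (∫ ω, Real.log (1 + FadingCSIT.snr (condDistrib ST H μ) Pol (H ω)) ∂μ) := by
  have hprob : IsProbabilityMeasure (μ.map H) := Measure.isProbabilityMeasure_map hH.aemeasurable
  have hν : μ.map H ⊗ₘ condDistrib ST H μ = μ.map fun ω => (H ω, ST ω) :=
    compProd_map_condDistrib hST.aemeasurable
  -- A non-integrable function has integral zero by convention, so the normalisation to one forces
  -- integrability.
  have hiH : Integrable (fun ω => ‖H ω‖ ^ 2) μ := by
    by_contra hcon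
    rw [integral_undef hcon] at hH2
    exact zero_ne_one hH2
  have hiH' : Integrable (fun h : ℂ => ‖h‖ ^ 2) (μ.map H) :=
    (integrable_map_measure (by fun_prop) hH.aemeasurable).2 hiH
  have hpower' : ∫⁻ p : ℂ × 𝒮, (Pol p.2 : ℝ≥0∞) ∂(μ.map H ⊗ₘ condDistrib ST H μ) ≤ Pmax := by
    rw [hν, lintegral_map (by fun_prop) (by fun_prop)]
    exact hpower
  have hint : Integrable (fun p : ℂ × 𝒮 => (Pol p.2 : ℝ)) (μ.map H ⊗ₘ condDistrib ST H μ) := by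
    refine ⟨(by fun_prop : Measurable _).aestronglyMeasurable, ?_⟩
    rw [hasFiniteIntegral_iff_ofReal (Filter.Eventually.of_forall fun _ => NNReal.coe_nonneg _)]
    simp only [ENNReal.ofReal_coe_nnreal]
    exact hpower'.trans_lt ENNReal.coe_lt_top
  have hI := FadingCSIT.integrable_log_one_add_snr hPol hiH' hint
  have hmean : ∫ ω, Real.log (1 + FadingCSIT.snr (condDistrib ST H μ) Pol (H ω)) ∂μ =
      ∫ h, Real.log (1 + FadingCSIT.snr (condDistrib ST H μ) Pol h) ∂μ.map H :=
    (integral_map hH.aemeasurable hI.1).symm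
  rw [hmean, ← hν]
  exact ⟨hI.comp_measurable hH, FadingCSIT.isGreatest_forwardGMIs hPol hiH' hint,
    FadingCSIT.isAchievableRate_integral_log hPol hiH' hint hpower'⟩
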